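/- **Setting.** Let $f:\mathbb R^n\to\mathbb R^n$, $g:\mathbb R^n\to\mathbb R^{n\times m}$, $f_c:\mathbb R^{n_c}\to\mathbb R^{n_c}$, $g_c:\mathbb R^{n_c}\to\mathbb R^{n_c\times m}$ and $h_c:\mathbb R^{n_c}\to\mathbb R^m$ be locally Lipschitz, let $h_1,\dots,h_\ell:\mathbb R^n\to\mathbb R$ and $\phi_1,\dots,\phi_{\ell_u}:\mathbb R^m\to\mathbb R$ be continuously differentiable, and put $S_s=\{x: h_j(x)\ge 0\ \forall j\}$, $\mathcal U=\{u:\phi_\kappa(u)\ge0\ \forall\kappa\}$, $S_c=\{x_c: h_c(x_c)\in\mathcal U\}$. For a differentiable $\eta$ and a vector field or matrix of vector fields $\psi$, $L_\psi\eta(x)=\eta'(x)\psi(x)$. All derivatives written below are assumed to exist and to be continuous. Assume that there are positive integers $d_1,\dots,d_\ell,d_c,\zeta$ such that: * (A1) for all $j$: $L_gL_f^ih_j=0$ on $\mathbb R^n$ for $0\le i\le d_j-2$, and $L_gL_f^{d_j-1}h_j(x)\ne0$ for all $x\in S_s$; * (C1) $L_{g_c}L_{f_c}^ih_c=0$ on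 $\mathbb R^{n_c}$ for $0\le i\le d_c-2$, and $L_{g_c}L_{f_c}^{d_c-1}h_c(x_c)$ is nonsingular for all $x_c\in\mathbb R^{n_c}$; * (C2) for all $\kappa$: $L_{g_c}L_{f_c}^i(\phi_\kappa\circ h_c)=0$ on $\mathbb R^{n_c}$ for $0\le i\le\zeta-2$, and $L_{g_c}L_{f_c}^{\zeta-1}(\phi_\kappa\circ h_c)(x_c)\ne0$ for all $x_c\in S_c$. Consider the cascade $\dot{\hat x}=\hat f(\hat x)+\hat g(\hat x)\hat u$ with state $\hat x=(x,x_c)\in\mathbb R^{n+n_c}$, input $\hat u\in\mathbb R^m$ and $$\hat f(\hat x)=\begin{bmatrix}f(x)+g(x)h_c(x_c)\\ f_c(x_c)\end{bmatrix},\qquad \hat g(\hat x)=\begin{bmatrix}0\\ g_c(x_c)\end{bmatrix}.$$ For $1\le j\le\ell$ let $\hat h_j(\hat x)=h_j(x)$ and $\hat d_j=d_j+d_c$; for $\ell+1\le j\le\hat\ell=\ell+\ell_u$ let $\hat h_j(\hat x)=\phi_{j-\ell}(h_c(x_c))$ and $\hat d_j=\zeta$. For $0\le i\le\hat d_j-2$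 let $\hat\alpha_{j,i}:\mathbb R\to\mathbb R$ be locally Lipschitz, strictly increasing, with $\hat\alpha_{j,i}(0)=0$. Let $\hat b_{j,0}=\hat h_j$ and $\hat b_{j,i+1}=L_{\hat f}\hat b_{j,i}+\hat\alpha_{j,i}\circ\hat b_{j,i}$. Let $\hat C_j=\{\hat b_{j,0}\ge0\}$ if $\hat d_j=1$, $\hat C_j=\bigcap_{i=0}^{\hat d_j-2}\{\hat b_{j,i}\ge0\}$ if $\hat d_j>1$, and $\hat C=\bigcap_{j=1}^{\hat\ell}\hat C_j$. Let $\rho>0$ and $$\hat h(\hat x)=-\frac1\rho\log\sum_{j=1}^{\hat\ell}e^{-\rho\,\hat b_{j,\hat d_j-1}(\hat x)},\quad \hat H=\{\hat h\ge0\},\quad \hat S=\hat H\cap\hat C,\quad \hat B=\{\hat x\in\operatorname{bd}\hat H: L_{\hat f}\hat h(\hat x)\le0\}.$$ A closed set $D$ of cascade states is *control forward invariant* if there is a locally Lipschitz feedback $\hat u$ on $D$ (equivalently, the restriction to $D$ of a locally Lipschitz feedback on $\mathbb R^{n+n_c}$) such that every solution of the closed loop that starts in $D$ stays in $D$ on its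 whole forward interval of existence. **Corollary.** Assume that $\hat h'$ is locally Lipschitz on $\hat H$ and that $L_{\hat g}\hat h(\hat x)\neq0$ for all $\hat x\in\hat B$. Then $\hat S$ is control forward invariant with respect to the cascade. -/

import Mathlib

namespace SoftMinCBF

section General

variable {X U F : Type*} [NormedAddCommGroup X] [NormedSpace ℝ X]
  [NormedAddCommGroup U] [NormedSpace ℝ U] [NormedAddCommGroup F] [NormedSpace ℝ F]

/-- The Lie derivative `L_f η (x) = η'(x) f(x)` along a vector field `f`. Iterated Lie derivatives
`L_f^i η` are written `(lieD f)^[i] η`. -/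
noncomputable def lieD (f : X → X) (η : X → F) : X → F :=
  fun x => fderiv ℝ η x (f x)

/-- The Lie derivative `L_g η (x) = η'(x) g(x)` along the columns of `g`, where the matrix `g x` is
regarded as a linear map from the input space to the state space. -/
noncomputable def lieG (g : X → U →L[ℝ] X) (η : X → F) : X → U →L[ℝ] F :=
  fun x => (fderiv ℝ η x).comp (g x)

/-- `x` is a solution on `[0, T)` of `x' = f x + g x (u x)`, `x 0 = x₀` (at `t = 0` the derivative
is one-sided). -/
def IsSolution (f : X → X) (g : X → U →L[ℝ] X) (u : X → U) (x₀ : X) (T : ℝ) (x : ℝ → X) : Prop :=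
  x 0 = x₀ ∧ ∀ t ∈ Set.Ico 0 T, HasDerivWithinAt x (f (x t) + g (x t) (u (x t))) (Set.Ici 0) t

/-- `D` is control forward invariant for `x' = f x + g x u`: there is a locally Lipschitz feedback
`u` under which every solution that starts in `D` remains in `D` as long as it exists. So that the
closed loop is a differential equation on the whole state space, `u` is locally Lipschitz on the
whole state space; only its values on `D` matter, and for closed `D` every locally Lipschitz
feedback on `D` has such an extension. -/
def ControlForwardInvariant (f : X → X) (g : X → U →L[ℝ] X) (D : Set X) : Prop :=
  ∃ u : X → U, LocallyLipschitz u ∧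
    ∀ x₀ ∈ D, ∀ (T : ℝ) (x : ℝ → X), IsSolution f g u x₀ T x → ∀ t ∈ Set.Ico 0 T, x t ∈ D

/-- Extended class-K functions. -/
def IsExtendedClassK (a : ℝ → ℝ) : Prop :=
  Continuous a ∧ StrictMono a ∧ a 0 = 0

/-- The log-sum-exp soft minimum. -/
noncomputable def softmin {ι : Type*} [Fintype ι] (ρ : ℝ) (z : ι → ℝ) : ℝ :=
  -(1 / ρ) * Real.log (∑ i, Real.exp (-ρ * z i))

/-- The set on which all functions of a family are nonnegative. -/
def safeSet {ι : Type*} (h : ι → X → ℝ) : Set X :=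
  {x | ∀ j, 0 ≤ h j x}

/-- `b 0 = η`, `b (i + 1) = L_f (b i) + α i ∘ b i`. -/
noncomputable def bSeq (f : X → X) (α : ℕ → ℝ → ℝ) (η : X → ℝ) : ℕ → X → ℝ
  | 0 => η
  | i + 1 => fun x => lieD f (bSeq f α η i) x + α i (bSeq f α η i x)

variable {ι : Type*} (f : X → X) (g : X → U →L[ℝ] X) (h : ι → X → ℝ) (d : ι → ℕ)
  (α : ι → ℕ → ℝ → ℝ) (ρ : ℝ)

/-- The set `C_j`: the `b_{j,i}`, `0 ≤ i ≤ d_j - 2`, are nonnegative; and `b_{j,0} ≥ 0`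
if `d_j = 1`. -/
def setCj (j : ι) : Set X :=
  if d j = 1 then {x | 0 ≤ bSeq f (α j) (h j) 0 x}
  else {x | ∀ i, i + 2 ≤ d j → 0 ≤ bSeq f (α j) (h j) i x}

/-- The intersection of all `C_j`. -/
def setC : Set X := ⋂ j, setCj f h d α j

/-- The composite function `softmin_ρ (b_{1, d_1 - 1}, …, b_{ℓ, d_ℓ - 1})`. -/
noncomputable def composite [Fintype ι] : X → ℝ :=
  fun x => softmin ρ (fun j => bSeq f (α j) (h j) (d j - 1) x)

/-- The zero-superlevel set of the composite function. -/
def setH [Fintype ι] : Set X := {x | 0 ≤ composite f h d α ρ x}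

/-- The intersection of `setH` and `setC`. -/
def setS [Fintype ι] : Set X := setH f h d α ρ ∩ setC f h d α

/-- The boundary points of `setH` where the Lie derivative of the composite function along `f`
is nonpositive. -/
def setB [Fintype ι] : Set X :=
  {x ∈ frontier (setH f h d α ρ) | lieD f (composite f h d α ρ) x ≤ 0}

/-- Condition A1 on the plant: for every `j`, `d_j` is positive, `L_g L_f^i h_j = 0` everywhere for
`0 ≤ i ≤ d_j - 2`, and `L_g L_f^(d_j - 1) h_j ≠ 0` on the safe set. The first clause after
positivity says that the derivatives written here exist and are continuous. -/
def CondA1 : Prop :=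
  ∀ j, 0 < d j ∧
    (∀ i, i < d j → ContDiff ℝ 1 ((lieD f)^[i] (h j))) ∧
    (∀ x, ∀ i, i + 2 ≤ d j → lieG g ((lieD f)^[i] (h j)) x = 0) ∧
    (∀ x ∈ safeSet h, lieG g ((lieD f)^[d j - 1] (h j)) x ≠ 0)

end General

section Cascade

variable {E Ec U : Type*} [NormedAddCommGroup E] [NormedSpace ℝ E]
  [NormedAddCommGroup Ec] [NormedSpace ℝ Ec] [NormedAddCommGroup U] [NormedSpace ℝ U]

/-- Condition C1 on the control dynamics: `d_c` is positive, `L_{g_c} L_{f_c}^i h_c = 0` for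
`0 ≤ i ≤ d_c - 2`, and `L_{g_c} L_{f_c}^(d_c - 1) h_c` is nonsingular, everywhere; the derivatives
written here exist and are continuous. -/
def CondC1 (fc : Ec → Ec) (gc : Ec → U →L[ℝ] Ec) (hc : Ec → U) (dc : ℕ) : Prop :=
  0 < dc ∧
    (∀ i, i < dc → ContDiff ℝ 1 ((lieD fc)^[i] hc)) ∧
    (∀ xc, ∀ i, i + 2 ≤ dc → lieG gc ((lieD fc)^[i] hc) xc = 0) ∧
    (∀ xc, IsUnit (lieG gc ((lieD fc)^[dc - 1] hc) xc))

/-- Condition C2 on the control dynamics: `ζ` is positive and for every `κ`,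
`L_{g_c} L_{f_c}^i (φ_κ ∘ h_c) = 0` everywhere for `0 ≤ i ≤ ζ - 2`, and
`L_{g_c} L_{f_c}^(ζ - 1) (φ_κ ∘ h_c) ≠ 0` at every controller state whose output is an admissible
control; the derivatives written here exist and are continuous. -/
def CondC2 {ι' : Type*} (fc : Ec → Ec) (gc : Ec → U →L[ℝ] Ec) (hc : Ec → U) (φ : ι' → U → ℝ)
    (ζ : ℕ) : Prop :=
  0 < ζ ∧ ∀ κ,
    (∀ i, i < ζ → ContDiff ℝ 1 ((lieD fc)^[i] (φ κ ∘ hc))) ∧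
    (∀ xc, ∀ i, i + 2 ≤ ζ → lieG gc ((lieD fc)^[i] (φ κ ∘ hc)) xc = 0) ∧
    (∀ xc, hc xc ∈ safeSet φ → lieG gc ((lieD fc)^[ζ - 1] (φ κ ∘ hc)) xc ≠ 0)

/-- The drift of the cascade: `(f x + g x (h_c x_c), f_c x_c)`. -/
def cascadeDrift (f : E → E) (g : E → U →L[ℝ] E) (fc : Ec → Ec) (hc : Ec → U) :
    E × Ec → E × Ec :=
  fun p => (f p.1 + g p.1 (hc p.2), fc p.2)

/-- The input matrix of the cascade: `(0, g_c x_c)`. -/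
noncomputable def cascadeInput (E : Type*) [NormedAddCommGroup E] [NormedSpace ℝ E]
    (gc : Ec → U →L[ℝ] Ec) : E × Ec → U →L[ℝ] E × Ec :=
  fun p => (ContinuousLinearMap.inr ℝ E Ec).comp (gc p.2)

/-- The constraint functions of the cascade: the `h_j x`, followed by the `φ_κ (h_c x_c)`. -/
def cascadeConstraint {ι ι' : Type*} (h : ι → E → ℝ) (φ : ι' → U → ℝ) (hc : Ec → U) :
    ι ⊕ ι' → E × Ec → ℝ :=
  Sum.elim (fun j p => h j p.1) (fun κ p => φ κ (hc p.2))

/-- The relative degrees for the cascade: `d_j + d_c` for the `h_j` and `ζ` for the `φ_κ ∘ h_c`. -/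
def cascadeDegree {ι : Type*} (ι' : Type*) (d : ι → ℕ) (dc ζ : ℕ) : ι ⊕ ι' → ℕ :=
  Sum.elim (fun j => d j + dc) (fun _ => ζ)

end Cascade

end SoftMinCBF

/-! A partition of unity glues constant inputs into a feedback that makes the soft minimum strictly
increase at the boundary of its superlevel set (`exists_feedback`), so that set is invariant. The
soft minimum lies below each of its arguments, hence the top functions `b (d j - 1)` stay
nonnegative. Where the input does not act on `b i`, the function `y = b i` satisfies `y' = b (i + 1)
- α i y` along solutions, and nonnegativity descends from `b (i + 1)` to `b i`
(`controlForwardInvariant_setS`).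

The substance is that the input does not act on `b i` for `i ≤ d j - 2` near the set. The `α i` are
only locally Lipschitz, so `α i ∘ b i` cannot be differentiated by the chain rule. Instead, `b i` is
locally a Lipschitz function of a jet of Lie derivatives, and a direction that annihilates the
derivative of the jet annihilates that of `b i` (`LipschitzVia.exists_fderiv_eq`). This passes from
`i` to `i + 1` because the next jet determines `b (i + 1)`, and a `C¹` function constant on the
fibres of a submersion is locally Lipschitz in it (`lipschitzVia_of_factors`,
`lipschitzVia_recursion`).

That the jets are submersions is classically read off iterated Lie brackets of drift and input
fields. These need not exist here; finite displacements transported by the backward flow replace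
them (`exists_direction`, `chain_jet_surjective`). -/

namespace SoftMinCBF

open Set Filter Topology Metric
open scoped NNReal Manifold ContDiff

/-! ### Local flows of Lipschitz fields -/

/-- Near any point, a locally Lipschitz vector field has a local flow that is jointly continuous. -/
lemma exists_local_flow {X : Type*} [NormedAddCommGroup X] [NormedSpace ℝ X] [CompleteSpace X]
    {f : X → X} (hf : LocallyLipschitz f) (x₀ : X) :
    ∃ r > 0, ∃ ε > 0, ∃ Ψ : X × ℝ → X,
      (∀ x ∈ closedBall x₀ r, Ψ (x, 0) = x ∧ ∀ t ∈ Icc (-ε) ε,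
        HasDerivWithinAt (fun s => Ψ (x, s)) (f (Ψ (x, t))) (Icc (-ε) ε) t) ∧
      ContinuousOn Ψ (closedBall x₀ r ×ˢ Icc (-ε) ε) := by
  obtain ⟨K, s, hs, hl⟩ := hf x₀
  obtain ⟨a, ha : 0 < a, has⟩ := nhds_basis_closedBall.mem_iff.mp hs
  set L : ℝ := K * a + ‖f x₀‖ + 1 with hL
  have hL0 : 0 < L := by positivity
  have hb : ∀ x ∈ closedBall x₀ a, ‖f x‖ ≤ L := fun x hx => by
    have h1 := hl.norm_sub_le (has hx) (mem_of_mem_nhds hs)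
    have h2 : (K : ℝ) * ‖x - x₀‖ ≤ K * a := by
      gcongr
      exact mem_closedBall_iff_norm.mp hx
    have h3 := norm_le_norm_sub_add (f x) (f x₀)
    linarith
  have hε : 0 < a / 2 / L := by positivity
  have hp : IsPicardLindelof (fun _ => f) (tmin := -(a / 2 / L)) (tmax := a / 2 / L)
      ⟨0, by constructor <;> linarith⟩ x₀ (.mk a ha.le) (.mk (a / 2) (half_pos ha).le)
      (.mk L hL0.le) K := by
    refine IsPicardLindelof.of_time_independent hb (hl.mono has) ?_
    simp only [NNReal.coe_mk, sub_zero, zero_sub, neg_neg, max_self]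
    rw [mul_div_cancel₀ _ hL0.ne']
    linarith
  obtain ⟨Ψ, h1, h2⟩ := hp.exists_forall_mem_closedBall_eq_hasDerivWithinAt_continuousOn
  exact ⟨a / 2, half_pos ha, _, hε, Ψ, h1, h2⟩

/-- Backward trajectories of a locally Lipschitz vector field that start near a backward trajectory
ending at `x₀` stay close to it, with displacement almost constant for short times. -/
lemma exists_backward_trajectories {X : Type*} [NormedAddCommGroup X] [NormedSpace ℝ X]
    [CompleteSpace X] {f : X → X} (hf : LocallyLipschitz f) (x₀ : X) :
    ∃ K : ℝ, 0 ≤ K ∧ ∀ V ∈ 𝓝 x₀, ∃ δ > 0, ∀ t ∈ Icc 0 δ, ∃ a : ℝ → X, a t = x₀ ∧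
      (∀ τ ∈ Icc 0 t, a τ ∈ V ∧ HasDerivWithinAt a (-f (a τ)) (Icc 0 t) τ) ∧
      ∀ᶠ y in 𝓝 (a 0), ∃ b : ℝ → X, b 0 = y ∧
        ∀ τ ∈ Icc 0 t, b τ ∈ V ∧ HasDerivWithinAt b (-f (b τ)) (Icc 0 t) τ ∧
          ‖(b τ - a τ) - (y - a 0)‖ ≤ K * τ * ‖y - a 0‖ := by
  obtain ⟨K, s, hs, hl⟩ := hf x₀
  obtain ⟨r, hr, ε, hε, Ψ, hΨ, hΨc⟩ := exists_local_flow hf x₀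
  -- Grönwall keeps the distance of two trajectories within a factor `exp K` for times at most 1,
  -- and their velocities differ by at most `K` times that distance.
  refine ⟨K * Real.exp K, by positivity, fun V hV => ?_⟩
  have hcont : ContinuousAt Ψ (x₀, 0) := hΨc.continuousAt
    (prod_mem_nhds (closedBall_mem_nhds _ hr) (Icc_mem_nhds (by linarith) hε))
  have h0 : Ψ (x₀, 0) = x₀ := (hΨ x₀ (mem_closedBall_self hr.le)).1
  have hnear : ∀ W ∈ 𝓝 x₀, ∃ r' > 0, ∃ δ > 0, ∀ y ∈ ball x₀ r', ∀ t, |t| ≤ δ →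
      Ψ (y, t) ∈ W := fun W hW => by
    have h1 := hcont.preimage_mem_nhds (h0.symm ▸ hW)
    obtain ⟨u, hu, v, hv, huv⟩ := mem_nhds_prod_iff.mp h1
    obtain ⟨r', hr', h2⟩ := Metric.mem_nhds_iff.mp hu
    obtain ⟨δ, hδ, h3⟩ := nhds_basis_closedBall.mem_iff.mp hv
    exact ⟨r', hr', δ, hδ, fun y hy t ht => huv ⟨h2 hy, h3 (by simpa using ht)⟩⟩
  obtain ⟨r₁, hr₁, δ₁, hδ₁, H₁⟩ := hnear (V ∩ s) (inter_mem hV hs)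
  -- The point reached forward from `x₀` must itself lie in the ball where the flow is controlled,
  -- so that a whole neighbourhood of it can be run backward.
  obtain ⟨r₂, hr₂, δ₂, hδ₂, H₂⟩ := hnear (ball x₀ (min r₁ r)) (ball_mem_nhds _ (lt_min hr₁ hr))
  refine ⟨min (min δ₁ δ₂) (min ε 1), by positivity, fun t ht => ?_⟩
  obtain ⟨ht0, ht1⟩ := ht
  simp only [le_min_iff] at ht1
  obtain ⟨⟨htδ₁, htδ₂⟩, htε, ht1⟩ := ht1
  have hback : ∀ y ∈ ball x₀ (min r₁ r), ∀ c ∈ Icc 0 t, ∀ τ ∈ Icc 0 t,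
      Ψ (y, c - τ) ∈ V ∩ s ∧ HasDerivWithinAt (fun σ => Ψ (y, c - σ))
        (-f (Ψ (y, c - τ))) (Icc 0 t) τ := fun y hy c hc τ hτ => by
    rw [mem_ball, lt_min_iff] at hy
    have habs : |c - τ| ≤ t := abs_le.mpr ⟨by linarith [hc.1, hτ.2], by linarith [hc.2, hτ.1]⟩
    refine ⟨H₁ y hy.1 _ (habs.trans htδ₁), ?_⟩
    have h1 := (hΨ y hy.2.le).2 (c - τ) (abs_le.mp (habs.trans htε))
    have h2 : HasDerivWithinAt (fun σ => c - σ) (-1) (Icc 0 t) τ :=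
      ((hasDerivAt_id τ).const_sub c).hasDerivWithinAt
    have h3 := h1.scomp τ h2 (fun σ hσ => by
      constructor <;> linarith [hc.1, hc.2, hσ.1, hσ.2])
    simpa [Function.comp_def] using h3
  have hx₀ : x₀ ∈ ball x₀ (min r₁ r) := mem_ball_self (lt_min hr₁ hr)
  refine ⟨fun τ => Ψ (x₀, t - τ), by simpa using h0, fun τ hτ => ?_, ?_⟩
  · obtain ⟨h1, h2⟩ := hback x₀ hx₀ t ⟨ht0, le_rfl⟩ τ hτ
    exact ⟨h1.1, h2⟩
  · have hmem : Ψ (x₀, t - 0) ∈ ball x₀ (min r₁ r) := by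
      rw [sub_zero]
      exact H₂ x₀ (mem_ball_self hr₂) t (by rwa [abs_of_nonneg ht0])
    filter_upwards [isOpen_ball.mem_nhds hmem] with y hy
    have hy0 : Ψ (y, 0) = y := (hΨ y (lt_min_iff.mp (mem_ball.mp hy)).2.le).1
    refine ⟨fun τ => Ψ (y, 0 - τ), by simpa using hy0, fun τ hτ => ?_⟩
    have hB := hback y hy 0 ⟨le_rfl, ht0⟩
    have hA := hback x₀ hx₀ t ⟨ht0, le_rfl⟩
    refine ⟨(hB τ hτ).1.1, (hB τ hτ).2, ?_⟩
    have hR : ∀ {γ : ℝ → X} {γ' : X} {σ : ℝ}, σ ∈ Ico 0 t →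
        HasDerivWithinAt γ γ' (Icc 0 t) σ → HasDerivWithinAt γ γ' (Ici σ) σ := by
      intro γ γ' σ hσ h
      refine h.mono_of_mem_nhdsWithin ?_
      filter_upwards [Icc_mem_nhdsGE hσ.2] with u hu using ⟨hσ.1.trans hu.1, hu.2⟩
    have hlneg : LipschitzOnWith K (fun x => -f x) s := fun x hx y hy => by
      rw [edist_neg_neg]; exact hl hx hy
    have hgr := dist_le_of_trajectories_ODE_of_mem (v := fun _ x => -f x) (s := fun _ => s)
      (K := K) (a := 0) (b := t) (f := fun τ => Ψ (y, 0 - τ)) (g := fun τ => Ψ (x₀, t - τ))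
      (fun _ _ => hlneg) (fun σ hσ => (hB σ hσ).2.continuousWithinAt)
      (fun σ hσ => hR hσ (hB σ (Ico_subset_Icc_self hσ)).2)
      (fun σ hσ => (hB σ (Ico_subset_Icc_self hσ)).1.2)
      (fun σ hσ => (hA σ hσ).2.continuousWithinAt)
      (fun σ hσ => hR hσ (hA σ (Ico_subset_Icc_self hσ)).2)
      (fun σ hσ => (hA σ (Ico_subset_Icc_self hσ)).1.2) le_rfl
    have hbound : ∀ σ ∈ Icc 0 t, ‖(-f (Ψ (y, 0 - σ))) - (-f (Ψ (x₀, t - σ)))‖ ≤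
        K * Real.exp K * ‖y - Ψ (x₀, t - 0)‖ := fun σ hσ => by
      have h1 := hlneg.norm_sub_le (hB σ hσ).1.2 (hA σ hσ).1.2
      have h2 := hgr σ hσ
      simp only [sub_zero, hy0] at h2
      have h3 : Real.exp (K * σ) ≤ Real.exp K :=
        Real.exp_le_exp.mpr (mul_le_of_le_one_right K.2 (hσ.2.trans ht1))
      rw [dist_eq_norm, dist_eq_norm] at h2
      rw [sub_zero]
      calc _ ≤ (K : ℝ) * ‖Ψ (y, 0 - σ) - Ψ (x₀, t - σ)‖ := h1
        _ ≤ K * (‖y - Ψ (x₀, t)‖ * Real.exp K) := by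
          have h4 := h2.trans (mul_le_mul_of_nonneg_left h3 (norm_nonneg _))
          gcongr
        _ = _ := by ring
    have hmv := norm_image_sub_le_of_norm_deriv_le_segment'
      (f := fun σ => Ψ (y, 0 - σ) - Ψ (x₀, t - σ)) (a := 0) (b := t)
      (fun σ hσ => (hB σ hσ).2.sub (hA σ hσ).2) (fun σ hσ => hbound σ (Ico_subset_Icc_self hσ))
      τ hτ
    simp only [sub_zero, hy0] at hmv ⊢
    linarith [hmv]

/-! ### Surjectivity of the jet of an integrator chain -/

section JetSurjectivity

variable {X Y U : Type*} [NormedAddCommGroup X] [NormedSpace ℝ X] [CompleteSpace X]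
  [NormedAddCommGroup Y] [NormedSpace ℝ Y] [NormedAddCommGroup U] [NormedSpace ℝ U]

/-- Integrating a chain `F' (l + 1) = -F l` whose first member is almost constant. -/
lemma norm_chain_sub_le {F : ℕ → ℝ → Y} {r : ℕ} {t ε κ s : ℝ} {w : Y} (ht1 : t ≤ 1)
    (hε : 0 ≤ ε) (hκ : 0 ≤ κ) (hs : 0 ≤ s)
    (hF : ∀ l, l + 1 < r → ∀ τ ∈ Icc 0 t, HasDerivWithinAt (F (l + 1)) (-F l τ) (Icc 0 t) τ)
    (h0 : ∀ τ ∈ Icc 0 t, ‖F 0 τ - s • w‖ ≤ ε * s)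
    (hi : ∀ l, l + 1 < r → ‖F (l + 1) 0‖ ≤ κ * s) :
    ∀ l, l < r → ∀ τ ∈ Icc 0 t,
      ‖F l τ - (s * ((-τ) ^ l / (l.factorial : ℝ))) • w‖ ≤ ε * s * τ ^ l + l * (κ * s) := by
  intro l
  induction l with
  | zero => intro _ τ hτ; simpa using h0 τ hτ
  | succ l ih =>
    intro hl τ₁ hτ₁
    have ih := ih (by omega)
    have hsub : Icc 0 τ₁ ⊆ Icc 0 t := Icc_subset_Icc_right hτ₁.2
    -- The terms `(-τ) ^ l / l!` obey the same chain relation, so the remainders do too, and the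
    -- mean value inequality raises the index by one.
    have hd : ∀ τ ∈ Icc 0 τ₁, HasDerivWithinAt
        (fun τ => F (l + 1) τ - (s * ((-τ) ^ (l + 1) / ((l + 1).factorial : ℝ))) • w)
        (-(F l τ - (s * ((-τ) ^ l / (l.factorial : ℝ))) • w)) (Icc 0 τ₁) τ := fun τ hτ => by
      have h1 := (hF l hl τ (hsub hτ)).mono hsub
      have h2 : HasDerivAt (fun τ : ℝ => s * ((-τ) ^ (l + 1) / ((l + 1).factorial : ℝ)))
          (-(s * ((-τ) ^ l / (l.factorial : ℝ)))) τ := by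
        have h3 := (((hasDerivAt_neg' τ).fun_pow (l + 1)).div_const
          ((l + 1).factorial : ℝ)).const_mul s
        refine h3.congr_deriv ?_
        have h4 : (l.factorial : ℝ) ≠ 0 := by positivity
        have h5 : (l : ℝ) + 1 ≠ 0 := by positivity
        simp only [Nat.factorial_succ, Nat.cast_mul, Nat.cast_add, Nat.cast_one,
          Nat.add_sub_cancel]
        field_simp
      have h3 := h1.sub ((h2.smul_const w).hasDerivWithinAt)
      exact h3.congr_deriv (by module)
    have hmv := norm_image_sub_le_of_norm_deriv_le_segment' hd
      (C := ε * s * τ₁ ^ l + l * (κ * s)) (fun τ hτ => by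
        rw [norm_neg]
        refine (ih τ (hsub (Ico_subset_Icc_self hτ))).trans ?_
        have := pow_le_pow_left₀ hτ.1 hτ.2.le l
        have h6 : 0 ≤ ε * s := by positivity
        gcongr) τ₁ ⟨hτ₁.1, le_rfl⟩
    have h0' : ((-(0 : ℝ)) ^ (l + 1)) = 0 := by simp
    rw [h0', zero_div, mul_zero, zero_smul, sub_zero, sub_zero] at hmv
    have h7 : (l * (κ * s)) * τ₁ ≤ l * (κ * s) :=
      mul_le_of_le_one_right (by positivity) (hτ₁.2.trans ht1)
    have h8 := norm_le_norm_sub_add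
      (F (l + 1) τ₁ - (s * ((-τ₁) ^ (l + 1) / ((l + 1).factorial : ℝ))) • w) (F (l + 1) 0)
    have h9 := hi l hl
    have h10 : τ₁ ^ (l + 1) = τ₁ ^ l * τ₁ := pow_succ _ _
    push_cast
    linarith [congrArg (fun x => ε * s * x) h10]

/-- A chain `p (l + 1)' f = p l` with `p (l + 1)' g = 0`: there are directions along which the
derivatives of the `p l` are close to `(-t) ^ l / l!` times `p 0' g v`. -/
lemma exists_direction {f : X → X} {g : X → U →L[ℝ] X} {p : ℕ → X → Y} {r : ℕ}
    (hf : LocallyLipschitz f) (hg : Continuous g)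
    (hp : ∀ l, l < r → ContDiff ℝ 1 (p l)) (hr : 0 < r)
    (hpf : ∀ l, l + 1 < r → ∀ x, fderiv ℝ (p (l + 1)) x (f x) = p l x)
    (hpg : ∀ l, l + 1 < r → ∀ x v, fderiv ℝ (p (l + 1)) x (g x v) = 0)
    (x₀ : X) (v : U) {ε : ℝ} (hε : 0 < ε) :
    ∃ δ > 0, ∀ t, 0 < t → t ≤ δ → ∃ e : X, ∀ l, l < r →
      ‖fderiv ℝ (p l) x₀ e - ((-t) ^ l / (l.factorial : ℝ)) • fderiv ℝ (p 0) x₀ (g x₀ v)‖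
        ≤ ε * t ^ l := by
  obtain ⟨K, hK, hback⟩ := exists_backward_trajectories hf x₀
  set A := fderiv ℝ (p 0) x₀ with hA
  set w := A (g x₀ v) with hw
  set G : ℝ := ‖g x₀ v‖ + 1 with hG
  have hG0 : 0 < G := by positivity
  -- Strict differentiability is needed: `p 0` is linearized between two moving points, neither of
  -- which is `x₀` in general.
  have hstrict : HasStrictFDerivAt (p 0) A x₀ :=
    (hp 0 hr).contDiffAt.hasStrictFDerivAt (by norm_num)
  have hη : 0 < ε / (8 * ((1 + K) * G)) := by positivity
  have hV₁ := hstrict.isLittleO.def hη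
  rw [nhds_prod_eq, eventually_prod_self_iff'] at hV₁
  obtain ⟨V₁, hV₁, hV₁'⟩ := hV₁
  have hgv : Continuous fun y => g y v := hg.clm_apply continuous_const
  have hV₂ : ∀ᶠ y in 𝓝 x₀, ‖g y v‖ < G :=
    hgv.norm.continuousAt.eventually_lt_const (by simp [hG])
  have hV₃ : ∀ᶠ y in 𝓝 x₀, ‖A (g y v) - w‖ < ε / 8 := by
    have : ContinuousAt (fun y => ‖A (g y v) - w‖) x₀ :=
      ((A.continuous.comp hgv).sub continuous_const).norm.continuousAt
    exact this.eventually_lt_const (by simp [hw, hε])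
  obtain ⟨δ, hδ, hδ'⟩ := hback _ (inter_mem hV₁ (inter_mem hV₂ hV₃))
  -- The last bound limits to `ε / 8` the error caused by the displacement not being exactly
  -- constant along the flow.
  refine ⟨min δ (min 1 (ε / (8 * (‖A‖ * K * G + 1)))), by positivity, fun t ht0 ht => ?_⟩
  simp only [le_min_iff] at ht
  obtain ⟨htδ, ht1, htA⟩ := ht
  obtain ⟨a, hat, ha, hb⟩ := hδ' t ⟨ht0.le, htδ⟩
  have ha0 := (ha 0 ⟨le_rfl, ht0.le⟩).1
  set g₀ := g (a 0) v with hg₀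
  have hg₀G : ‖g₀‖ ≤ G := le_of_lt ha0.2.1
  set M : ℝ := r + (1 + K) * G + 1 with hM
  have hM0 : 0 < M := by positivity
  -- Chosen after `t`: the `M` errors of size `κ` then total at most `ε / 2 * t ^ l` for every `l <
  -- r`.
  set κ : ℝ := ε / 2 * t ^ r / M with hκ
  have hκ0 : 0 < κ := by positivity
  have hline : Tendsto (fun s : ℝ => a 0 + s • g₀) (𝓝[>] 0) (𝓝 (a 0)) := by
    have : Continuous fun s : ℝ => a 0 + s • g₀ := by fun_prop
    simpa using (this.tendsto 0).mono_left nhdsWithin_le_nhds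
  -- The starting point is displaced along the input direction, which only `p 0` sees to first
  -- order.
  have hinit : ∀ᶠ s : ℝ in 𝓝[>] 0, ∀ l ∈ Finset.range r, l + 1 < r →
      ‖p (l + 1) (a 0 + s • g₀) - p (l + 1) (a 0)‖ ≤ κ * s := by
    rw [Finset.eventually_all]
    intro l _
    by_cases hl : l + 1 < r
    · have h1 : HasFDerivAt (p (l + 1)) (fderiv ℝ (p (l + 1)) (a 0)) (a 0) :=
        ((hp _ hl).differentiable (by norm_num) _).hasFDerivAt
      have h2 : HasDerivAt (fun s : ℝ => a 0 + s • g₀) g₀ 0 := by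
        simpa using ((hasDerivAt_id (0 : ℝ)).smul_const g₀).const_add (a 0)
      have h3 : HasDerivAt (fun s : ℝ => p (l + 1) (a 0 + s • g₀)) 0 0 := by
        have h4 := HasFDerivAt.comp_hasDerivAt (x := (0 : ℝ)) (f := fun s : ℝ => a 0 + s • g₀)
          (l := p (l + 1)) (by simpa using h1) h2
        rwa [hpg l hl (a 0) v] at h4
      have h5 := (hasDerivAt_iff_isLittleO.mp h3).def hκ0
      filter_upwards [nhdsWithin_le_nhds h5, self_mem_nhdsWithin] with s hs hs0 _
      simpa [abs_of_pos (show (0 : ℝ) < s from hs0)] using hs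
    · exact Eventually.of_forall fun s h => absurd h hl
  have hdiff : ∀ᶠ z in 𝓝 x₀, ∀ l ∈ Finset.range r,
      ‖p l z - p l x₀ - fderiv ℝ (p l) x₀ (z - x₀)‖ ≤ κ * ‖z - x₀‖ := by
    rw [Finset.eventually_all]
    intro l hl
    have h1 : HasFDerivAt (p l) (fderiv ℝ (p l) x₀) x₀ :=
      ((hp _ (Finset.mem_range.mp hl)).differentiable (by norm_num) _).hasFDerivAt
    exact h1.isLittleO.def hκ0
  obtain ⟨ρ, hρ, hρ'⟩ := Metric.eventually_nhds_iff_ball.mp hdiff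
  have hsmall : ∀ᶠ s : ℝ in 𝓝[>] 0, (1 + K) * G * s < ρ := by
    have : Continuous fun s : ℝ => (1 + K) * G * s := by fun_prop
    exact nhdsWithin_le_nhds (this.continuousAt.eventually_lt_const (by simpa using hρ))
  obtain ⟨s, hs0, hbs, hs1, hs2⟩ := ((eventually_mem_nhdsWithin (a := (0 : ℝ)) (s := Ioi 0)).and
    ((hline.eventually hb).and (hinit.and hsmall))).exists
  replace hs0 : 0 < s := hs0
  obtain ⟨b, hb0, hb⟩ := hbs
  have hy : ‖(a 0 + s • g₀) - a 0‖ ≤ s * G := by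
    rw [add_sub_cancel_left, norm_smul, Real.norm_of_nonneg hs0.le]
    gcongr
  have hΔ : ∀ τ ∈ Icc 0 t, ‖(b τ - a τ) - s • g₀‖ ≤ K * τ * (s * G) := fun τ hτ => by
    have h1 := (hb τ hτ).2.2
    rw [show (a 0 + s • g₀) - a 0 = s • g₀ by abel] at h1 hy
    have := hτ.1
    exact h1.trans (by gcongr)
  have hΔ' : ∀ τ ∈ Icc 0 t, ‖b τ - a τ‖ ≤ (1 + K) * G * s := fun τ hτ => by
    have h1 := hΔ τ hτ
    rw [add_sub_cancel_left] at hy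
    have h2 := norm_le_norm_sub_add (b τ - a τ) (s • g₀)
    have h3 : K * τ * (s * G) ≤ K * 1 * (s * G) := by
      gcongr
      exact hτ.2.trans ht1
    linarith
  have hchain := norm_chain_sub_le (F := fun l τ => p l (b τ) - p l (a τ)) (r := r) (t := t)
    (ε := ε / 2) (κ := κ) (s := s) (w := w) ht1 (by positivity) hκ0.le hs0.le
    (fun l hl τ hτ => by
      have h1 : ∀ x, HasFDerivAt (p (l + 1)) (fderiv ℝ (p (l + 1)) x) x := fun x =>
        ((hp _ hl).differentiable (by norm_num) _).hasFDerivAt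
      have h2 := ((h1 _).comp_hasDerivWithinAt τ (hb τ hτ).2.1).sub
        ((h1 _).comp_hasDerivWithinAt τ (ha τ hτ).2)
      rw [map_neg, map_neg, hpf l hl, hpf l hl] at h2
      exact h2.congr_deriv (by abel))
    (fun τ hτ => by
      have h1 := hV₁' (b τ) (hb τ hτ).1.1 (a τ) (ha τ hτ).1.1
      have h2 : ‖A (b τ - a τ) - A (s • g₀)‖ ≤ ‖A‖ * (K * τ * (s * G)) := by
        rw [← map_sub]
        exact (A.le_opNorm _).trans (by gcongr; exact hΔ τ hτ)
      have h3 : ‖A (s • g₀) - s • w‖ ≤ s * (ε / 8) := by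
        rw [map_smul, ← smul_sub, norm_smul, Real.norm_of_nonneg hs0.le]
        exact mul_le_mul_of_nonneg_left ha0.2.2.le hs0.le
      have h4 : ε / (8 * ((1 + K) * G)) * ‖b τ - a τ‖ ≤ s * (ε / 8) := by
        calc _ ≤ ε / (8 * ((1 + K) * G)) * ((1 + K) * G * s) := by gcongr; exact hΔ' τ hτ
          _ = _ := by field_simp
      have h5 : ‖A‖ * (K * τ * (s * G)) ≤ s * (ε / 8) := by
        have h6 : τ ≤ ε / (8 * (‖A‖ * K * G + 1)) := hτ.2.trans htA
        rw [le_div_iff₀ (by positivity)] at h6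
        have h7 : (‖A‖ * K * G) * τ ≤ ε / 8 := by
          have := hτ.1
          linarith
        calc _ = s * ((‖A‖ * K * G) * τ) := by ring
          _ ≤ _ := by gcongr
      have h8 := norm_le_norm_sub_add (p 0 (b τ) - p 0 (a τ) - s • w)
        (A (b τ - a τ) - s • w)
      have h9 := norm_le_norm_sub_add (A (b τ - a τ) - s • w) (A (s • g₀) - s • w)
      rw [sub_sub_sub_cancel_right] at h8 h9
      have h10 : 0 < s * ε := by positivity
      have h1' : ‖p 0 (b τ) - p 0 (a τ) - A (b τ - a τ)‖ ≤
        ε / (8 * ((1 + K) * G)) * ‖b τ - a τ‖ := h1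
      linarith)
    (fun l hl => by
      have := hs1 l (Finset.mem_range.mpr (by omega)) hl
      simpa [hb0] using this)
  have hz : ‖b t - x₀‖ ≤ (1 + K) * G * s := hat ▸ hΔ' t ⟨ht0.le, le_rfl⟩
  -- The direction is the rescaled displacement after transport to `x₀`, in place of an exponential
  -- series of brackets.
  refine ⟨s⁻¹ • (b t - x₀), fun l hl => ?_⟩
  have h1 := hchain l hl t ⟨ht0.le, le_rfl⟩
  simp only [hat] at h1
  have h2 := hρ' (b t) (by rw [mem_ball, dist_eq_norm]; linarith) l (Finset.mem_range.mpr hl)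
  rw [norm_sub_rev] at h2
  have h3 : κ * ‖b t - x₀‖ ≤ κ * ((1 + K) * G * s) := by gcongr
  have h4 := norm_le_norm_sub_add (fderiv ℝ (p l) x₀ (b t - x₀) -
    (s * ((-t) ^ l / (l.factorial : ℝ))) • w)
    (p l (b t) - p l x₀ - (s * ((-t) ^ l / (l.factorial : ℝ))) • w)
  rw [sub_sub_sub_cancel_right] at h4
  have h5 : (l : ℝ) * (κ * s) ≤ r * (κ * s) := by gcongr
  have h6 : M * κ * s ≤ ε / 2 * t ^ l * s := by
    rw [hκ, mul_div_cancel₀ _ hM0.ne']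
    have : t ^ r ≤ t ^ l := pow_le_pow_of_le_one ht0.le ht1 hl.le
    gcongr
  have h7 : 0 < κ * s := by positivity
  have h8 : M * κ * s = r * (κ * s) + κ * ((1 + K) * G * s) + κ * s := by rw [hM]; ring
  have h9 : fderiv ℝ (p l) x₀ (s⁻¹ • (b t - x₀)) - ((-t) ^ l / (l.factorial : ℝ)) • w =
      s⁻¹ • (fderiv ℝ (p l) x₀ (b t - x₀) - (s * ((-t) ^ l / (l.factorial : ℝ))) • w) := by
    rw [map_smul, smul_sub, smul_smul, ← mul_assoc, inv_mul_cancel₀ hs0.ne', one_mul]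
  rw [h9, norm_smul, norm_inv, Real.norm_of_nonneg hs0.le, inv_mul_le_iff₀ hs0]
  linarith

/-- The output of an integrator chain driven through a surjective input matrix has a surjective
jet. -/
lemma chain_jet_surjective [FiniteDimensional ℝ Y] {f : X → X} {g : X → U →L[ℝ] X}
    {p : ℕ → X → Y} {r : ℕ}
    (hf : LocallyLipschitz f) (hg : Continuous g)
    (hp : ∀ l, l < r → ContDiff ℝ 1 (p l))
    (hpf : ∀ l, l + 1 < r → ∀ x, fderiv ℝ (p (l + 1)) x (f x) = p l x)
    (hpg : ∀ l, l + 1 < r → ∀ x v, fderiv ℝ (p (l + 1)) x (g x v) = 0)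
    (x₀ : X) (hsurj : Function.Surjective fun v => fderiv ℝ (p 0) x₀ (g x₀ v)) :
    Function.Surjective
      (ContinuousLinearMap.pi fun l : Fin r => fderiv ℝ (p l) x₀ : X →L[ℝ] Fin r → Y) := by
  set D : X →L[ℝ] Fin r → Y := ContinuousLinearMap.pi fun l : Fin r => fderiv ℝ (p l) x₀
  by_contra hns
  -- A nonzero functional annihilating the range is refuted by its lowest nonzero component: that
  -- one pairs to order `t ^ l₀`, all higher ones to order `t ^ (l₀ + 1)`.
  obtain ⟨μ, hμ0, hμ⟩ := Submodule.exists_le_ker_of_lt_top (LinearMap.range D.toLinearMap)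
    (lt_top_iff_ne_top.mpr fun h => hns (LinearMap.range_eq_top.mp h))
  let ν : Fin r → Y →L[ℝ] ℝ := fun l =>
    LinearMap.toContinuousLinearMap (μ.comp (LinearMap.single ℝ (fun _ => Y) l))
  have hsum : ∀ y : Fin r → Y, μ y = ∑ l, ν l (y l) := fun y => by
    conv_lhs => rw [← LinearMap.sum_single_apply (fun _ => Y) y, map_sum]
    rfl
  have hD : ∀ e, ∑ l : Fin r, ν l (fderiv ℝ (p l) x₀ e) = 0 := fun e => by
    exact (hsum (D e)).symm.trans (hμ ⟨e, rfl⟩)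
  have hex : ∃ l, ν l ≠ 0 := by
    by_contra! h
    exact hμ0 (LinearMap.ext fun y => by simp [hsum, h])
  obtain ⟨l₀, hl₀, hmin⟩ : ∃ l₀, ν l₀ ≠ 0 ∧ ∀ l < l₀, ν l = 0 := by
    classical
    have hne : (Finset.univ.filter fun l => ν l ≠ 0).Nonempty := by
      simpa [Finset.filter_nonempty_iff] using hex
    refine ⟨_, (Finset.mem_filter.mp (Finset.min'_mem _ hne)).2, fun l hl => ?_⟩
    by_contra h
    exact absurd (Finset.min'_le _ l (by simpa using h)) (not_le.mpr hl)
  obtain ⟨y, hy⟩ : ∃ y, ν l₀ y ≠ 0 := by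
    by_contra! h
    exact hl₀ (ContinuousLinearMap.ext h)
  obtain ⟨v, rfl⟩ := hsurj y
  set w := fderiv ℝ (p 0) x₀ (g x₀ v) with hw
  have hr : 0 < r := l₀.pos
  set c : ℝ := |ν l₀ w| / ((l₀ : ℕ).factorial : ℝ) with hc
  have hc0 : 0 < c := by positivity
  set M : ℝ := (∑ l, ‖ν l‖) * (‖w‖ + 1) with hM
  have hM0 : 0 ≤ M := by positivity
  -- This makes the error in the leading pairing at most `c / 4`; the choice of `t` below does the
  -- same for the tail, leaving `c ≤ c / 2`.
  set ε : ℝ := min 1 (c / (4 * (‖ν l₀‖ + 1))) with hε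
  have hε0 : 0 < ε := by positivity
  obtain ⟨δ, hδ, hdir⟩ := exists_direction hf hg hp hr hpf hpg x₀ v hε0
  set t : ℝ := min δ (min 1 (c / (4 * (M + 1)))) with ht
  have ht0 : 0 < t := by positivity
  have ht1 : t ≤ 1 := (min_le_right _ _).trans (min_le_left _ _)
  obtain ⟨e, he⟩ := hdir t ht0 (min_le_left _ _)
  have hfact : ∀ l : ℕ, |(-t) ^ l / (l.factorial : ℝ)| ≤ t ^ l := fun l => by
    rw [abs_div, abs_pow, abs_neg, abs_of_pos ht0, Nat.abs_cast]
    exact div_le_self (by positivity) (by exact_mod_cast Nat.factorial_pos l)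
  have hrest : ∀ l ∈ Finset.univ.erase l₀,
      |ν l (fderiv ℝ (p l) x₀ e)| ≤ ‖ν l‖ * ((‖w‖ + 1) * (t ^ (l₀ : ℕ) * t)) := fun l hl => by
    rcases lt_or_gt_of_ne (Finset.ne_of_mem_erase hl) with h | h
    · simp [hmin l h]
    · refine ((ν l).le_opNorm _).trans ?_
      gcongr
      have h1 := he l l.2
      have h2 := norm_le_norm_sub_add (fderiv ℝ (p l) x₀ e)
        (((-t) ^ (l : ℕ) / ((l : ℕ).factorial : ℝ)) • w)
      rw [norm_smul, Real.norm_eq_abs] at h2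
      have h3 := mul_le_mul_of_nonneg_right (hfact l) (norm_nonneg w)
      have h4 : ε * t ^ (l : ℕ) ≤ 1 * t ^ (l : ℕ) := by
        gcongr
        exact min_le_left _ _
      have h5 : t ^ (l : ℕ) ≤ t ^ (l₀ : ℕ) * t := by
        rw [← pow_succ]
        exact pow_le_pow_of_le_one ht0.le ht1 h
      calc _ ≤ (‖w‖ + 1) * t ^ (l : ℕ) := by linarith
        _ ≤ _ := by gcongr
  have h1 := hD e
  rw [← Finset.add_sum_erase _ _ (Finset.mem_univ l₀)] at h1
  have h2 : |ν l₀ (fderiv ℝ (p l₀) x₀ e)| ≤ M * (t ^ (l₀ : ℕ) * t) := by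
    rw [eq_neg_of_add_eq_zero_left h1, abs_neg]
    calc _ ≤ ∑ l ∈ Finset.univ.erase l₀, |ν l (fderiv ℝ (p l) x₀ e)| :=
          Finset.abs_sum_le_sum_abs _ _
      _ ≤ ∑ l ∈ Finset.univ.erase l₀, ‖ν l‖ * ((‖w‖ + 1) * (t ^ (l₀ : ℕ) * t)) :=
          Finset.sum_le_sum hrest
      _ ≤ ∑ l, ‖ν l‖ * ((‖w‖ + 1) * (t ^ (l₀ : ℕ) * t)) :=
          Finset.sum_le_sum_of_subset_of_nonneg (Finset.erase_subset _ _)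
            fun _ _ _ => by positivity
      _ = _ := by rw [← Finset.sum_mul, hM, mul_assoc]
  have h3 : |ν l₀ (fderiv ℝ (p l₀) x₀ e) -
      ν l₀ (((-t) ^ (l₀ : ℕ) / ((l₀ : ℕ).factorial : ℝ)) • w)| ≤ ‖ν l₀‖ * (ε * t ^ (l₀ : ℕ)) := by
    rw [← map_sub]
    exact ((ν l₀).le_opNorm _).trans (by gcongr; exact he l₀ l₀.2)
  have h4 : |ν l₀ (((-t) ^ (l₀ : ℕ) / ((l₀ : ℕ).factorial : ℝ)) • w)| = c * t ^ (l₀ : ℕ) := by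
    rw [map_smul, smul_eq_mul, abs_mul, abs_div, abs_pow, abs_neg, abs_of_pos ht0, Nat.abs_cast,
      hc]
    ring
  have h5 : c * t ^ (l₀ : ℕ) ≤ ‖ν l₀‖ * (ε * t ^ (l₀ : ℕ)) + M * (t ^ (l₀ : ℕ) * t) := by
    rw [← h4]
    have := abs_sub_abs_le_abs_sub (ν l₀ (((-t) ^ (l₀ : ℕ) / ((l₀ : ℕ).factorial : ℝ)) • w))
      (ν l₀ (fderiv ℝ (p l₀) x₀ e))
    rw [abs_sub_comm] at this
    linarith
  have h6 : c ≤ ‖ν l₀‖ * ε + M * t := by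
    have : 0 < t ^ (l₀ : ℕ) := by positivity
    refine le_of_mul_le_mul_right ?_ this
    linarith
  have h7 : ‖ν l₀‖ * ε ≤ c / 4 := by
    have h8 : ε ≤ c / (4 * (‖ν l₀‖ + 1)) := min_le_right _ _
    rw [le_div_iff₀ (by positivity)] at h8
    linarith
  have h8 : M * t ≤ c / 4 := by
    have h8 : t ≤ c / (4 * (M + 1)) := (min_le_right _ _).trans (min_le_right _ _)
    rw [le_div_iff₀ (by positivity)] at h8
    linarith
  linarith

end JetSurjectivity

/-! ### Functions that depend on a submersion in a Lipschitz way -/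

section LipschitzFactor

variable {X Y Z Z' U : Type*} [NormedAddCommGroup X] [NormedSpace ℝ X]
  [NormedAddCommGroup Y] [NormedSpace ℝ Y] [NormedAddCommGroup Z] [NormedSpace ℝ Z]
  [NormedAddCommGroup Z'] [NormedSpace ℝ Z'] [NormedAddCommGroup U] [NormedSpace ℝ U]

/-- Near `x₀`, the function `b` is a Lipschitz function of `z`. -/
def LipschitzVia (b : X → ℝ) (z : X → Z) (x₀ : X) : Prop :=
  ∃ C : ℝ, ∃ V ∈ 𝓝 x₀, ∀ p ∈ V, ∀ p' ∈ V, ‖b p - b p'‖ ≤ C * ‖z p - z p'‖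

/-- The derivative of a Lipschitz function of `z` along `v` is determined by `z` and the derivative
of `z` along `v`. -/
lemma LipschitzVia.exists_fderiv_eq {b : X → ℝ} {z : X → Z} {x₀ : X} (h : LipschitzVia b z x₀)
    (hb : Differentiable ℝ b) (hz : Differentiable ℝ z) :
    ∃ W ∈ 𝓝 x₀, ∀ p ∈ W, ∀ p' ∈ W, z p = z p' → ∀ v v', fderiv ℝ z p v = fderiv ℝ z p' v' →
      fderiv ℝ b p v = fderiv ℝ b p' v' := by
  obtain ⟨C, V, hV, hC⟩ := h
  obtain ⟨W, hWV, hW, hx₀⟩ := _root_.mem_nhds_iff.mp hV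
  refine ⟨W, hW.mem_nhds hx₀, fun p hp p' hp' hpp v v' hv => ?_⟩
  have hline : ∀ (q w : X), HasDerivAt (fun s : ℝ => q + s • w) w 0 := fun q w => by
    simpa using ((hasDerivAt_id (0 : ℝ)).smul_const w).const_add q
  have hbq : ∀ q w, HasDerivAt (fun s : ℝ => b (q + s • w)) (fderiv ℝ b q w) 0 := fun q w =>
    HasFDerivAt.comp_hasDerivAt (x := (0 : ℝ)) (f := fun s : ℝ => q + s • w) (l := b)
      (by simpa using (hb q).hasFDerivAt) (hline q w)
  have hzq : ∀ q w, HasDerivAt (fun s : ℝ => z (q + s • w)) (fderiv ℝ z q w) 0 := fun q w =>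
    HasFDerivAt.comp_hasDerivAt (x := (0 : ℝ)) (f := fun s : ℝ => q + s • w) (l := z)
      (by simpa using (hz q).hasFDerivAt) (hline q w)
  have hmem : ∀ q ∈ W, ∀ w, ∀ᶠ s : ℝ in 𝓝 0, q + s • w ∈ W := fun q hq w =>
    (hline q w).continuousAt.eventually_mem (by simpa using hW.mem_nhds hq)
  have h1 := (hbq p v).sub (hbq p' v')
  have h2 := (hzq p v).sub (hzq p' v')
  rw [hv, sub_self] at h2
  have h3 : b p - b p' = 0 := by
    have := hC p (hWV hp) p' (hWV hp')
    rw [hpp, sub_self, norm_zero, mul_zero] at this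
    exact norm_le_zero_iff.mp this
  -- Along the two lines the values of `z` agree to first order, so their difference is `o(s)`; the
  -- Lipschitz bound passes this on to `b`.
  have h4 : HasDerivAt ((fun s : ℝ => b (p + s • v)) - fun s : ℝ => b (p' + s • v')) 0 0 := by
    rw [hasDerivAt_iff_isLittleO] at h2 ⊢
    have hz0 : ((fun s : ℝ => z (p + s • v)) - fun s : ℝ => z (p' + s • v')) 0 = 0 := by
      simp [hpp]
    have hb0 : ((fun s : ℝ => b (p + s • v)) - fun s : ℝ => b (p' + s • v')) 0 = 0 := by
      simp [h3]
    simp only [hz0, hb0, smul_zero, sub_zero] at h2 ⊢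
    refine Asymptotics.IsBigO.trans_isLittleO (Asymptotics.IsBigO.of_bound C ?_) h2
    filter_upwards [hmem p hp v, hmem p' hp' v'] with s hs hs'
    exact hC _ (hWV hs) _ (hWV hs')
  exact sub_eq_zero.mp (h1.unique h4)

/-- A Lipschitz function of `z` has zero derivative along directions that leave `z` fixed. -/
lemma LipschitzVia.eventually_lieG_eq_zero {b : X → ℝ} {z : X → Z} {x₀ : X}
    (h : LipschitzVia b z x₀) (hb : Differentiable ℝ b) (hz : Differentiable ℝ z)
    {g : X → U →L[ℝ] X} (hg : ∀ p u, fderiv ℝ z p (g p u) = 0) :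
    ∀ᶠ p in 𝓝 x₀, lieG g b p = 0 := by
  obtain ⟨W, hW, hW'⟩ := h.exists_fderiv_eq hb hz
  filter_upwards [hW] with p hp
  ext u
  simpa [lieG] using hW' p hp p hp rfl (g p u) 0 (by simp [hg])

/-- A `C¹` function that factors through a submersion is a Lipschitz function of it. -/
lemma lipschitzVia_of_factors [CompleteSpace X] [CompleteSpace Z] {b : X → ℝ} {z : X → Z} {x₀ : X}
    (hb : ContDiff ℝ 1 b) (hz : ContDiff ℝ 1 z) (hsurj : Function.Surjective (fderiv ℝ z x₀))
    (hfac : ∃ W ∈ 𝓝 x₀, ∀ p ∈ W, ∀ p' ∈ W, z p = z p' → b p = b p') :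
    LipschitzVia b z x₀ := by
  obtain ⟨W, hW, hW'⟩ := hfac
  obtain ⟨K, s, hs, hl⟩ := hb.contDiffAt.exists_lipschitzOnWith (x := x₀)
  obtain ⟨R, hR⟩ := (fderiv ℝ z x₀).exists_nonlinearRightInverse_of_surjective
    (LinearMap.range_eq_top.mpr hsurj)
  have hN : (0 : ℝ) < (R.nnnorm : ℝ)⁻¹ := by positivity
  have hstrict : HasStrictFDerivAt z (fderiv ℝ z x₀) x₀ :=
    hz.contDiffAt.hasStrictFDerivAt (by norm_num)
  obtain ⟨V, hV, happ⟩ := hstrict.approximates_deriv_on_nhds (c := R.nnnorm⁻¹ / 2)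
    (Or.inr (by positivity))
  obtain ⟨ρ, hρ, hball⟩ := nhds_basis_closedBall.mem_iff.mp (inter_mem hV (inter_mem hW hs))
  -- The nonlinear error takes half of the inverse bound; the other half `c` is the covering rate:
  -- the image of a ball of radius `ε` contains one of radius `c * ε`.
  set c : ℝ := (R.nnnorm : ℝ)⁻¹ / 2 with hc
  have hc0 : 0 < c := by positivity
  have hnear : ∀ᶠ p in 𝓝 x₀, ‖z p - z x₀‖ < c * (ρ / 4) := by
    have : Continuous fun p => ‖z p - z x₀‖ := (hz.continuous.sub continuous_const).norm
    exact this.continuousAt.eventually_lt_const (by simp; positivity)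
  refine ⟨K / c, closedBall x₀ (ρ / 2) ∩ {p | ‖z p - z x₀‖ < c * (ρ / 4)},
    inter_mem (closedBall_mem_nhds _ (by positivity)) hnear, fun p hp p' hp' => ?_⟩
  have hzz : ‖z p - z p'‖ ≤ c * (ρ / 2) := by
    have h1 := norm_sub_le_norm_sub_add_norm_sub (z p) (z x₀) (z p')
    have h2 := hp.2
    have h3 := hp'.2
    rw [mem_ofPred_eq] at h2 h3
    rw [norm_sub_rev] at h3
    linarith
  set ε := ‖z p - z p'‖ / c with hε
  have hε0 : 0 ≤ ε := by positivity
  have hερ : ε ≤ ρ / 2 := by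
    rw [hε, div_le_iff₀ hc0]
    linarith
  have hsub : closedBall p ε ⊆ closedBall x₀ ρ := closedBall_subset_closedBall' (by
    have := mem_closedBall.mp hp.1
    linarith)
  -- Replace `p'` by a point of the same fibre whose distance to `p` is controlled by `‖z p - z
  -- p'‖`; `b` does not notice.
  obtain ⟨p'', hp'', hzp''⟩ := happ.surjOn_closedBall_of_nonlinearRightInverse R hε0
    (hsub.trans (hball.trans inter_subset_left)) (show z p' ∈ _ by
      rw [mem_closedBall, dist_eq_norm, norm_sub_rev]
      push_cast
      rw [show (R.nnnorm : ℝ)⁻¹ - (R.nnnorm : ℝ)⁻¹ / 2 = c by rw [hc]; ring, hε,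
        mul_div_cancel₀ _ hc0.ne'])
  have hin : ∀ q ∈ closedBall x₀ (ρ / 2), q ∈ V ∩ (W ∩ s) := fun q hq =>
    hball (closedBall_subset_closedBall (by linarith) hq)
  have hp''m := hball (hsub hp'')
  have h1 : b p'' = b p' := hW' p'' hp''m.2.1 p' (hin p' hp'.1).2.1 hzp''
  rw [← h1]
  refine (hl.norm_sub_le (hin p hp.1).2.2 hp''m.2.2).trans ?_
  have h2 : ‖p - p''‖ ≤ ε := by
    rw [← dist_eq_norm, dist_comm]
    exact hp''
  calc (K : ℝ) * ‖p - p''‖ ≤ K * ε := by gcongr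
    _ = _ := by rw [hε]; ring

/-- The recursion `b (i + 1) = L_f (b i) + a i ∘ b i` preserves being a Lipschitz function of a
submersion `z i`, if `z (i + 1)` determines `z i` and its derivative along `f`. -/
lemma lipschitzVia_recursion [CompleteSpace X] {Z : ℕ → Type*} [∀ k, NormedAddCommGroup (Z k)]
    [∀ k, NormedSpace ℝ (Z k)] [∀ k, CompleteSpace (Z k)] {z : ∀ k, X → Z k} {f : X → X}
    {b : ℕ → X → ℝ} {a : ℕ → ℝ → ℝ} {N : ℕ} {x₀ : X}
    (hb : ∀ i, i ≤ N → ContDiff ℝ 1 (b i))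
    (hstep : ∀ i, i < N → ∀ x, b (i + 1) x = lieD f (b i) x + a i (b i x))
    (hz : ∀ i, i ≤ N → ContDiff ℝ 1 (z i))
    (hsurj : ∀ i, i ≤ N → Function.Surjective (fderiv ℝ (z i) x₀))
    (hdet : ∀ i, i < N → ∀ p p', z (i + 1) p = z (i + 1) p' →
      z i p = z i p' ∧ fderiv ℝ (z i) p (f p) = fderiv ℝ (z i) p' (f p'))
    (h0 : LipschitzVia (b 0) (z 0) x₀) :
    ∀ i, i ≤ N → LipschitzVia (b i) (z i) x₀ := by
  intro i
  induction i with
  | zero => exact fun _ => h0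
  | succ i ih =>
    intro hi
    have ih := ih (by omega)
    obtain ⟨W, hW, hW'⟩ := ih.exists_fderiv_eq ((hb i (by omega)).differentiable (by norm_num))
      ((hz i (by omega)).differentiable (by norm_num))
    obtain ⟨C, V, hV, hC⟩ := ih
    -- Only the values of `a i` enter; the regularity of `b (i + 1)` is supplied by `hb`.
    refine lipschitzVia_of_factors (hb _ hi) (hz _ hi) (hsurj _ hi)
      ⟨W ∩ V, inter_mem hW hV, fun p hp p' hp' hpp => ?_⟩
    obtain ⟨h1, h2⟩ := hdet i (by omega) p p' hpp
    have h3 : b i p = b i p' := by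
      have := hC p hp.2 p' hp'.2
      rw [h1, sub_self, norm_zero, mul_zero] at this
      exact sub_eq_zero.mp (norm_le_zero_iff.mp this)
    rw [hstep i (by omega), hstep i (by omega), h3]
    congr 1
    exact hW' p hp.1 p' hp'.1 h1 _ _ h2

-- Used to trade the plant jet for the full plant state, where the recursion over plant jets hands
-- over to the one over controller jets.
omit [NormedSpace ℝ X] in
lemma LipschitzVia.comp {b : X → ℝ} {z : X → Z} {x₀ : X} (h : LipschitzVia b z x₀) {y : X → Z'}
    {F : Z' → Z} (hF : ContDiff ℝ 1 F) (hzy : z = F ∘ y) (hy : ContinuousAt y x₀) :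
    LipschitzVia b y x₀ := by
  obtain ⟨C, V, hV, hC⟩ := h
  obtain ⟨K, s, hs, hl⟩ := hF.contDiffAt.exists_lipschitzOnWith (x := y x₀)
  refine ⟨|C| * K, V ∩ y ⁻¹' s, inter_mem hV (hy.preimage_mem_nhds hs), fun p hp p' hp' => ?_⟩
  have h1 : ‖z p - z p'‖ ≤ K * ‖y p - y p'‖ := by
    rw [hzy]
    exact hl.norm_sub_le hp.2 hp'.2
  calc ‖b p - b p'‖ ≤ C * ‖z p - z p'‖ := hC p hp.1 p' hp'.1
    _ ≤ |C| * (K * ‖y p - y p'‖) := by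
      gcongr
      exact le_abs_self C
    _ = _ := by ring

end LipschitzFactor

/-! ### Jets of iterated Lie derivatives -/

section Jets

variable {X Y U : Type*} [NormedAddCommGroup X] [NormedSpace ℝ X]
  [NormedAddCommGroup Y] [NormedSpace ℝ Y] [NormedAddCommGroup U] [NormedSpace ℝ U]

/-- The first `k` iterated Lie derivatives of `η` along `f`, starting with `η` itself. -/
noncomputable def lieJet (f : X → X) (η : X → Y) (k : ℕ) : X → Fin k → Y :=
  fun x i => (lieD f)^[i] η x

variable {f : X → X} {g : X → U →L[ℝ] X} {η : X → Y} {r k : ℕ}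

lemma contDiff_lieJet (h : ∀ i, i < r → ContDiff ℝ 1 ((lieD f)^[i] η)) (hk : k ≤ r) :
    ContDiff ℝ 1 (lieJet f η k) :=
  contDiff_pi.mpr fun i => h i (by omega)

lemma fderiv_lieJet (h : ∀ i, i < r → ContDiff ℝ 1 ((lieD f)^[i] η)) (hk : k ≤ r) (x : X) :
    fderiv ℝ (lieJet f η k) x =
      ContinuousLinearMap.pi fun i : Fin k => fderiv ℝ ((lieD f)^[i] η) x :=
  fderiv_pi fun i => ((h i (by omega)).differentiable (by norm_num)) x

lemma lieD_iterate_succ (f : X → X) (η : X → Y) (i : ℕ) (x : X) :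
    (lieD f)^[i + 1] η x = fderiv ℝ ((lieD f)^[i] η) x (f x) := by
  rw [Function.iterate_succ_apply']
  rfl

/-- Differentiation along `f` shifts the jet by one entry. -/
lemma lieJet_succ_determines (h : ∀ i, i < r → ContDiff ℝ 1 ((lieD f)^[i] η)) (hk : k ≤ r)
    {x x' : X} (hx : lieJet f η (k + 1) x = lieJet f η (k + 1) x') :
    lieJet f η k x = lieJet f η k x' ∧
      fderiv ℝ (lieJet f η k) x (f x) = fderiv ℝ (lieJet f η k) x' (f x') := by
  refine ⟨funext fun i => congrFun hx i.castSucc, ?_⟩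
  rw [fderiv_lieJet h hk, fderiv_lieJet h hk]
  ext i
  have := congrFun hx i.succ
  simpa [lieJet, lieD_iterate_succ] using this

/-- A jet of length `k < r` stops before index `r - 1`, the only one below `r` on which the input
may act. -/
lemma fderiv_lieJet_input (h : ∀ i, i < r → ContDiff ℝ 1 ((lieD f)^[i] η))
    (h0 : ∀ x, ∀ i, i + 2 ≤ r → lieG g ((lieD f)^[i] η) x = 0) (hk : k + 1 ≤ r) (x : X) (u : U) :
    fderiv ℝ (lieJet f η k) x (g x u) = 0 := by
  rw [fderiv_lieJet h (by omega)]
  ext i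
  exact DFunLike.congr_fun (h0 x i (by omega)) u

/-- If the relative degree of `η` is `r` at `x₀`, then its jets up to that order are submersions
at `x₀`. -/
lemma fderiv_lieJet_surjective [CompleteSpace X] [FiniteDimensional ℝ Y]
    (hf : LocallyLipschitz f) (hg : Continuous g)
    (h : ∀ i, i < r → ContDiff ℝ 1 ((lieD f)^[i] η))
    (h0 : ∀ x, ∀ i, i + 2 ≤ r → lieG g ((lieD f)^[i] η) x = 0) {x₀ : X}
    (hsurj : Function.Surjective (lieG g ((lieD f)^[r - 1] η) x₀)) (hk : k ≤ r) :
    Function.Surjective (fderiv ℝ (lieJet f η k) x₀) := by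
  have hsub : ∀ l, l + 1 < r → r - 1 - l = r - 1 - (l + 1) + 1 := fun l hl => by omega
  -- The chain is indexed downward from the highest Lie derivative, the one the input drives.
  have hD := chain_jet_surjective (p := fun l => (lieD f)^[r - 1 - l] η) (r := r) hf hg
    (fun l hl => h _ (by omega))
    (fun l hl x => by
      rw [hsub l hl, lieD_iterate_succ])
    (fun l hl x v => DFunLike.congr_fun (h0 x _ (by omega)) v) x₀ hsurj
  rw [fderiv_lieJet h hk]
  intro y
  obtain ⟨e, he⟩ := hD fun l => if hl : r - 1 - l < k then y ⟨r - 1 - l, hl⟩ else 0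
  refine ⟨e, funext fun i => ?_⟩
  have h1 := congrFun he ⟨r - 1 - i, by omega⟩
  have h2 : r - 1 - (r - 1 - (i : ℕ)) = i := by omega
  simpa [h2] using h1

end Jets

/-! ### Relative degrees in the cascade -/

section CascadeRelativeDegree

variable {E Ec U Z : Type*} [NormedAddCommGroup E] [NormedSpace ℝ E]
  [NormedAddCommGroup Ec] [NormedSpace ℝ Ec] [NormedAddCommGroup U] [NormedSpace ℝ U]
  [NormedAddCommGroup Z] [NormedSpace ℝ Z]

lemma fderiv_comp_fst {F : E → Z} (hF : Differentiable ℝ F) (p v : E × Ec) :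
    fderiv ℝ (fun q : E × Ec => F q.1) p v = fderiv ℝ F p.1 v.1 := by
  have h := (hF p.1).hasFDerivAt.comp p (hasFDerivAt_fst (𝕜 := ℝ) (p := p))
  exact DFunLike.congr_fun h.fderiv v

lemma fderiv_comp_snd {F : Ec → Z} (hF : Differentiable ℝ F) (p v : E × Ec) :
    fderiv ℝ (fun q : E × Ec => F q.2) p v = fderiv ℝ F p.2 v.2 := by
  have h := (hF p.2).hasFDerivAt.comp p (hasFDerivAt_snd (𝕜 := ℝ) (p := p))
  exact DFunLike.congr_fun h.fderiv v

lemma fderiv_prodMk_fst_comp_snd {F : Ec → Z} (hF : Differentiable ℝ F) (p v : E × Ec) :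
    fderiv ℝ (fun q : E × Ec => (q.1, F q.2)) p v = (v.1, fderiv ℝ F p.2 v.2) := by
  have h := (hasFDerivAt_fst (𝕜 := ℝ) (p := p)).prodMk
    ((hF p.2).hasFDerivAt.comp p (hasFDerivAt_snd (𝕜 := ℝ) (p := p)))
  exact DFunLike.congr_fun h.fderiv v

lemma surjective_of_ne_zero {A : U →L[ℝ] ℝ} (hA : A ≠ 0) : Function.Surjective A := by
  refine LinearMap.surjective (f := (A : U →ₗ[ℝ] ℝ)) fun h => hA ?_
  ext u
  exact DFunLike.congr_fun h u

variable [CompleteSpace E] [CompleteSpace Ec] {f : E → E} {g : E → U →L[ℝ] E} {fc : Ec → Ec}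
  {gc : Ec → U →L[ℝ] Ec} {hc : Ec → U} {a : ℕ → ℝ → ℝ} {p₀ : E × Ec}

/-- The input of the cascade does not act on the functions generated by a constraint on the
controller state, below its relative degree. -/
lemma eventually_lieG_bSeq_snd {η : Ec → ℝ} {ζ : ℕ} (hfc : LocallyLipschitz fc)
    (hgc : Continuous gc)
    (h : ∀ i, i < ζ → ContDiff ℝ 1 ((lieD fc)^[i] η))
    (h0 : ∀ x, ∀ i, i + 2 ≤ ζ → lieG gc ((lieD fc)^[i] η) x = 0)
    (hne : lieG gc ((lieD fc)^[ζ - 1] η) p₀.2 ≠ 0)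
    (hb : ∀ i, i + 2 ≤ ζ →
      ContDiff ℝ 1 (bSeq (cascadeDrift f g fc hc) a (fun p => η p.2) i))
    {i : ℕ} (hi : i + 2 ≤ ζ) :
    ∀ᶠ p in 𝓝 p₀, lieG (cascadeInput E gc)
      (bSeq (cascadeDrift f g fc hc) a (fun p => η p.2) i) p = 0 := by
  have hJ : ∀ k, k ≤ ζ → ContDiff ℝ 1 (lieJet fc η k) := fun k hk => contDiff_lieJet h hk
  have hJd : ∀ k, k ≤ ζ → Differentiable ℝ (lieJet fc η k) := fun k hk =>
    (hJ k hk).differentiable (by norm_num)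
  have hvia := lipschitzVia_recursion (f := cascadeDrift f g fc hc) (N := ζ - 2) (x₀ := p₀)
    (Z := fun k => Fin (k + 1) → ℝ) (z := fun k p => lieJet fc η (k + 1) p.2) (a := a)
    (b := bSeq (cascadeDrift f g fc hc) a (fun p => η p.2))
    (fun i hi' => hb i (by omega)) (fun _ _ _ => rfl)
    (fun k hk => (hJ (k + 1) (by omega)).comp contDiff_snd)
    (fun k hk y => by
      obtain ⟨e, he⟩ := fderiv_lieJet_surjective hfc hgc h h0 (surjective_of_ne_zero hne)
        (show k + 1 ≤ ζ by omega) y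
      exact ⟨(0, e), by rw [fderiv_comp_snd (hJd _ (by omega)), ← he]⟩)
    (fun k hk p p' hpp => by
      rw [fderiv_comp_snd (hJd _ (by omega)), fderiv_comp_snd (hJd _ (by omega))]
      exact lieJet_succ_determines h (by omega) hpp)
    ⟨1, univ, univ_mem, fun p _ p' _ => by
      rw [one_mul]
      exact norm_le_pi_norm (lieJet fc η 1 p.2 - lieJet fc η 1 p'.2) 0⟩ i (by omega)
  refine hvia.eventually_lieG_eq_zero ((hb i hi).differentiable (by norm_num))
    ((hJd _ (by omega)).comp differentiable_snd) fun p u => ?_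
  rw [fderiv_comp_snd (hJd _ (by omega))]
  exact fderiv_lieJet_input h h0 (by omega) p.2 u

/-- The input of the cascade does not act on the functions generated by a constraint on the plant
state, below the sum of the relative degrees of the plant and of the control dynamics. -/
lemma eventually_lieG_bSeq_fst [FiniteDimensional ℝ U] {η : E → ℝ} {d dc : ℕ}
    (hf : LocallyLipschitz f) (hg : Continuous g) (hfc : LocallyLipschitz fc)
    (hgc : Continuous gc) (hd : 0 < d) (hdc : 0 < dc)
    (h : ∀ i, i < d → ContDiff ℝ 1 ((lieD f)^[i] η))
    (h0 : ∀ x, ∀ i, i + 2 ≤ d → lieG g ((lieD f)^[i] η) x = 0)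
    (hne : lieG g ((lieD f)^[d - 1] η) p₀.1 ≠ 0)
    (h' : ∀ i, i < dc → ContDiff ℝ 1 ((lieD fc)^[i] hc))
    (h0' : ∀ x, ∀ i, i + 2 ≤ dc → lieG gc ((lieD fc)^[i] hc) x = 0)
    (hsurj : Function.Surjective (lieG gc ((lieD fc)^[dc - 1] hc) p₀.2))
    (hb : ∀ i, i + 2 ≤ d + dc →
      ContDiff ℝ 1 (bSeq (cascadeDrift f g fc hc) a (fun p => η p.1) i))
    {i : ℕ} (hi : i + 2 ≤ d + dc) :
    ∀ᶠ p in 𝓝 p₀, lieG (cascadeInput E gc)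
      (bSeq (cascadeDrift f g fc hc) a (fun p => η p.1) i) p = 0 := by
  have hJ : ∀ k, k ≤ d → ContDiff ℝ 1 (lieJet f η k) := fun k hk => contDiff_lieJet h hk
  have hJd : ∀ k, k ≤ d → Differentiable ℝ (lieJet f η k) := fun k hk =>
    (hJ k hk).differentiable (by norm_num)
  have hJ' : ∀ k, k ≤ dc → ContDiff ℝ 1 (lieJet fc hc k) := fun k hk => contDiff_lieJet h' hk
  have hJd' : ∀ k, k ≤ dc → Differentiable ℝ (lieJet fc hc k) := fun k hk =>
    (hJ' k hk).differentiable (by norm_num)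
  have hvia := lipschitzVia_recursion (f := cascadeDrift f g fc hc) (N := d - 1) (x₀ := p₀)
    (Z := fun k => Fin (k + 1) → ℝ) (z := fun k p => lieJet f η (k + 1) p.1) (a := a)
    (b := bSeq (cascadeDrift f g fc hc) a (fun p => η p.1))
    (fun i hi' => hb i (by omega)) (fun _ _ _ => rfl)
    (fun k hk => (hJ (k + 1) (by omega)).comp contDiff_fst)
    (fun k hk y => by
      obtain ⟨e, he⟩ := fderiv_lieJet_surjective hf hg h h0 (surjective_of_ne_zero hne)
        (show k + 1 ≤ d by omega) y
      exact ⟨(e, 0), by rw [fderiv_comp_fst (hJd _ (by omega)), ← he]⟩)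
    (fun k hk p p' hpp => by
      rw [fderiv_comp_fst (hJd _ (by omega)), fderiv_comp_fst (hJd _ (by omega))]
      -- Below the plant's relative degree the term `g x (h_c x_c)` of the drift drops out, so the
      -- drift acts on the jet as `f` does.
      simp only [cascadeDrift, map_add, fderiv_lieJet_input h h0 (show k + 1 + 1 ≤ d by omega),
        add_zero]
      exact lieJet_succ_determines h (by omega) hpp)
    ⟨1, univ, univ_mem, fun p _ p' _ => by
      rw [one_mul]
      exact norm_le_pi_norm (lieJet f η 1 p.1 - lieJet f η 1 p'.1) 0⟩
  rcases le_or_gt i (d - 1) with hid | hid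
  · refine (hvia i hid).eventually_lieG_eq_zero ((hb i hi).differentiable (by norm_num))
      ((hJd _ (by omega)).comp differentiable_fst) fun p u => ?_
    rw [fderiv_comp_fst (hJd _ (by omega))]
    simp [cascadeInput]
  · obtain ⟨k, rfl⟩ := Nat.exists_eq_add_of_le hid.le
    -- From index `d - 1` on, the jet is the whole plant state with the first `k` Lie derivatives of
    -- `hc`; at `k = 0` no controller data are present yet.
    have hvia' := lipschitzVia_recursion (f := cascadeDrift f g fc hc) (N := dc - 1) (x₀ := p₀)
      (Z := fun k => E × (Fin k → U)) (z := fun k p => (p.1, lieJet fc hc k p.2))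
      (a := fun k => a (d - 1 + k))
      (b := fun k => bSeq (cascadeDrift f g fc hc) a (fun p => η p.1) (d - 1 + k))
      (fun i hi' => hb _ (by omega)) (fun _ _ _ => rfl)
      (fun k hk => contDiff_fst.prodMk ((hJ' k (by omega)).comp contDiff_snd))
      (fun k hk y => by
        obtain ⟨e, he⟩ := fderiv_lieJet_surjective hfc hgc h' h0' hsurj
          (show k ≤ dc by omega) y.2
        exact ⟨(y.1, e), by rw [fderiv_prodMk_fst_comp_snd (hJd' _ (by omega)), he]⟩)
      (fun k hk p p' hpp => by
        rw [fderiv_prodMk_fst_comp_snd (hJd' _ (by omega)),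
          fderiv_prodMk_fst_comp_snd (hJd' _ (by omega))]
        obtain ⟨h1, h2⟩ := Prod.ext_iff.mp hpp
        obtain ⟨h3, h4⟩ := lieJet_succ_determines h' (show k ≤ dc by omega) h2
        -- The plant part of the drift needs the controller output, which is entry 0 of the jet of
        -- length `k + 1`.
        have h5 : hc p.2 = hc p'.2 := congrFun h2 0
        dsimp only at h1
        simp only [cascadeDrift, h1, h3, h4, h5, and_self])
      ((hvia (d - 1) le_rfl).comp (F := fun q : E × (Fin 0 → U) => lieJet f η (d - 1 + 1) q.1)
        ((hJ _ (by omega)).comp contDiff_fst) rfl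
        (contDiff_fst.prodMk ((hJ' 0 (by omega)).comp contDiff_snd)).continuous.continuousAt)
      k (by omega)
    refine hvia'.eventually_lieG_eq_zero ((hb _ hi).differentiable (by norm_num))
      ((contDiff_fst.prodMk ((hJ' k (by omega)).comp contDiff_snd)).differentiable (by norm_num))
      fun p u => ?_
    rw [fderiv_prodMk_fst_comp_snd (hJd' _ (by omega))]
    exact Prod.ext rfl (fderiv_lieJet_input h' h0' (by omega) p.2 u)

end CascadeRelativeDegree

/-! ### Feedback and invariance -/

section Invariance

variable {X U : Type*} [NormedAddCommGroup X] [NormedSpace ℝ X]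
  [NormedAddCommGroup U] [NormedSpace ℝ U]

lemma lieD_add_lieG (f : X → X) (g : X → U →L[ℝ] X) (η : X → ℝ) (x : X) (u : U) :
    fderiv ℝ η x (f x + g x u) = lieD f η x + lieG g η x u := by
  simp [lieD, lieG]

/-- If at the boundary points of the superlevel set where the drift does not increase `η` the input
acts on `η`, then a smooth feedback makes `η` strictly increase at the boundary. -/
lemma exists_feedback [FiniteDimensional ℝ X] {f : X → X} {g : X → U →L[ℝ] X} {η : X → ℝ}
    (hf : Continuous f) (hg : Continuous g) (hη : ContDiff ℝ 1 η) {S : Set X}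
    (hS : ∀ x ∈ frontier S, lieD f η x ≤ 0 → lieG g η x ≠ 0) :
    ∃ u : X → U, LocallyLipschitz u ∧
      ∀ x ∈ frontier S, 0 < lieD f η x + lieG g η x (u x) := by
  -- The admissible inputs form a convex set, unrestricted off the frontier, and locally a constant
  -- input is admissible; this is what the partition of unity requires.
  let t : X → Set U := fun x => {u | x ∈ frontier S → 0 < lieD f η x + lieG g η x u}
  have ht : ∀ x, Convex ℝ (t x) := fun x => by
    by_cases hx : x ∈ frontier S
    · have : t x = (lieG g η x) ⁻¹' Ioi (-lieD f η x) := by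
        ext u
        simp [t, hx, neg_lt_iff_pos_add']
      rw [this]
      exact (convex_Ioi _).linear_preimage (lieG g η x).toLinearMap
    · have : t x = univ := by
        ext u
        simp [t, hx]
      rw [this]
      exact convex_univ
  have hloc : ∀ x : X, ∃ c : U, ∀ᶠ y in 𝓝 x, c ∈ t y := fun x => by
    by_cases hx : x ∈ frontier S
    · have hpos : ∃ c, 0 < lieD f η x + lieG g η x c := by
        rcases lt_or_ge 0 (lieD f η x) with h | h
        · exact ⟨0, by simpa using h⟩
        · obtain ⟨c, hc⟩ := surjective_of_ne_zero (hS x hx h) (1 - lieD f η x)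
          exact ⟨c, by rw [hc]; linarith⟩
      obtain ⟨c, hc⟩ := hpos
      have hcont : Continuous fun y => fderiv ℝ η y (f y + g y c) :=
        (hη.continuous_fderiv (by norm_num)).clm_apply
          (hf.add (hg.clm_apply continuous_const))
      simp only [lieD_add_lieG] at hcont
      refine ⟨c, ?_⟩
      filter_upwards [hcont.continuousAt.eventually_const_lt hc] with y hy _ using hy
    · refine ⟨0, ?_⟩
      filter_upwards [isClosed_frontier.isOpen_compl.mem_nhds hx] with y hy hy' using
        absurd hy' hy
  obtain ⟨u, hu⟩ := exists_contMDiffMap_forall_mem_convex_of_local_const (n := 1) 𝓘(ℝ, X) ht hloc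
  exact ⟨u, u.contMDiff.contDiff.locallyLipschitz, fun x hx => hu x hx⟩

omit [NormedSpace ℝ X] in
/-- Continuous induction along a curve that remains in a closed set for a short time whenever it is
in that set. -/
lemma forall_mem_of_forall_eventually_mem {D : Set X} (hD : IsClosed D) {x : ℝ → X} {T : ℝ}
    (hx : ContinuousOn x (Ico 0 T)) (h0 : x 0 ∈ D)
    (hstep : ∀ s ∈ Ico 0 T, x s ∈ D → ∀ᶠ t in 𝓝[>] s, x t ∈ D) :
    ∀ t ∈ Ico 0 T, x t ∈ D := fun t ht => by
  have hsub : Icc 0 t ⊆ Ico 0 T := fun s hs => ⟨hs.1, hs.2.trans_lt ht.2⟩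
  have hcl : IsClosed (x ⁻¹' D ∩ Icc 0 t) := by
    rw [inter_comm]
    exact (hx.mono hsub).preimage_isClosed_of_isClosed isClosed_Icc hD
  exact hcl.Icc_subset_of_forall_mem_nhdsWithin h0
    (fun s hs => hstep s (hsub (Ico_subset_Icc_self hs.2)) hs.1) ⟨ht.1, le_rfl⟩

/-- A superlevel set is invariant if its defining function strictly increases at its boundary. -/
lemma IsSolution.mem_superlevel {f : X → X} {g : X → U →L[ℝ] X} {u : X → U} {η : X → ℝ}
    (hη : ContDiff ℝ 1 η)
    (hu : ∀ x ∈ frontier {x | 0 ≤ η x}, 0 < lieD f η x + lieG g η x (u x))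
    {x₀ : X} {T : ℝ} {x : ℝ → X} (hx : IsSolution f g u x₀ T x) (h0 : 0 ≤ η x₀) :
    ∀ t ∈ Ico 0 T, 0 ≤ η (x t) := by
  have hcont : ContinuousOn x (Ico 0 T) := fun t ht =>
    (hx.2 t ht).continuousWithinAt.mono fun s hs => hs.1
  refine forall_mem_of_forall_eventually_mem (D := {x | 0 ≤ η x})
    (isClosed_le continuous_const hη.continuous) hcont (by simpa [hx.1] using h0)
    fun s hs hsD => ?_
  have hle : 𝓝[>] s ≤ 𝓝[Ici 0] s := nhdsWithin_mono s fun t ht => hs.1.trans (le_of_lt ht)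
  by_cases hint : x s ∈ interior {x | 0 ≤ η x}
  · have h1 := (hx.2 s hs).continuousWithinAt.eventually_mem (isOpen_interior.mem_nhds hint)
    filter_upwards [hle h1] with t ht using
      interior_subset (s := {x | 0 ≤ η x}) ht
  · have hfr := hu (x s) ⟨subset_closure hsD, hint⟩
    rw [← lieD_add_lieG] at hfr
    have h1 := ((hη.differentiable (by norm_num) (x s)).hasFDerivAt.comp_hasDerivWithinAt s
      (hx.2 s hs)).mono (show Ioi s ⊆ Ici 0 from fun t ht => hs.1.trans (le_of_lt ht))
    rw [hasDerivWithinAt_iff_tendsto_slope' self_notMem_Ioi] at h1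
    filter_upwards [h1.eventually_const_lt hfr, self_mem_nhdsWithin] with t ht hst
    have h2 : 0 < t - s := sub_pos.mpr hst
    rw [slope_def_field, lt_div_iff₀ h2, zero_mul, sub_pos] at ht
    exact le_trans hsD ht.le

/-- Scalar comparison: `y' = c - a (y)` with `c ≥ 0` and `a ≤ 0` on negative numbers keeps `y`
nonnegative. -/
lemma nonneg_of_hasDerivWithinAt {y c : ℝ → ℝ} {a : ℝ → ℝ} {s e : ℝ} (hs : 0 ≤ s)
    (hy : ∀ t ∈ Ico s e, HasDerivWithinAt y (c t - a (y t)) (Ici 0) t)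
    (hc : ∀ t ∈ Ico s e, 0 ≤ c t) (ha : ∀ z < 0, a z ≤ 0) (hys : 0 ≤ y s) :
    ∀ t ∈ Ico s e, 0 ≤ y t := by
  intro t₁ ht₁
  by_contra! hneg
  have hcont : ContinuousOn y (Icc s t₁) := fun t ht =>
    (hy t ⟨ht.1, ht.2.trans_lt ht₁.2⟩).continuousWithinAt.mono fun r hr => hs.trans hr.1
  have hcpt : IsCompact (Icc s t₁ ∩ y ⁻¹' Ici 0) :=
    isCompact_Icc.of_isClosed_subset (hcont.preimage_isClosed_of_isClosed isClosed_Icc isClosed_Ici)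
      inter_subset_left
  -- After the last time `τ` with `y ≥ 0`, `y` is negative, so its derivative is nonnegative and it
  -- cannot have decreased.
  obtain ⟨τ, hτ, hmax⟩ := hcpt.exists_isGreatest ⟨s, ⟨le_rfl, ht₁.1⟩, hys⟩
  have hmono : MonotoneOn y (Icc τ t₁) := by
    have hat : ∀ t ∈ Ioo τ t₁, HasDerivAt y (c t - a (y t)) t := fun t ht =>
      (hy t ⟨hτ.1.1.trans ht.1.le, ht.2.trans ht₁.2⟩).hasDerivAt
        (Ici_mem_nhds ((hs.trans hτ.1.1).trans_lt ht.1))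
    refine monotoneOn_of_deriv_nonneg (convex_Icc _ _)
      (hcont.mono (Icc_subset_Icc_left hτ.1.1)) ?_ ?_
    · rw [interior_Icc]
      exact fun t ht => (hat t ht).differentiableAt.differentiableWithinAt
    · rw [interior_Icc]
      intro t ht
      rw [(hat t ht).deriv]
      have h1 : y t < 0 := by
        by_contra! h
        exact absurd (hmax ⟨⟨hτ.1.1.trans ht.1.le, ht.2.le⟩, h⟩) (not_le.mpr ht.1)
      have h2 := hc t ⟨hτ.1.1.trans ht.1.le, ht.2.trans ht₁.2⟩
      linarith [ha _ h1]
  have h3 := hmono ⟨le_rfl, hτ.1.2⟩ ⟨hτ.1.2, le_rfl⟩ hτ.1.2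
  have h4 : 0 ≤ y τ := hτ.2
  linarith

/-- Each exponential is bounded by the sum, whose logarithm is nonpositive. -/
lemma nonneg_of_softmin_nonneg {ι : Type*} [Fintype ι] {ρ : ℝ} (hρ : 0 < ρ) {z : ι → ℝ}
    (h : 0 ≤ softmin ρ z) (j : ι) : 0 ≤ z j := by
  have hle : Real.exp (-ρ * z j) ≤ ∑ i, Real.exp (-ρ * z i) :=
    Finset.single_le_sum (f := fun i => Real.exp (-ρ * z i)) (fun i _ => (Real.exp_pos _).le)
      (Finset.mem_univ j)
  have hlog : Real.log (∑ i, Real.exp (-ρ * z i)) ≤ 0 := by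
    rw [softmin, neg_mul, Left.nonneg_neg_iff] at h
    exact nonpos_of_mul_nonpos_right h (by positivity)
  have h1 := (Real.log_le_log (Real.exp_pos _) hle).trans hlog
  rw [Real.log_exp] at h1
  by_contra! h2
  nlinarith

variable {ι : Type*} [Fintype ι] {f : X → X} {g : X → U →L[ℝ] X} {h : ι → X → ℝ} {d : ι → ℕ}
  {α : ι → ℕ → ℝ → ℝ} {ρ : ℝ}

lemma bSeq_top_nonneg (hρ : 0 < ρ) {x : X} (hx : x ∈ setH f h d α ρ) (j : ι) :
    0 ≤ bSeq f (α j) (h j) (d j - 1) x :=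
  nonneg_of_softmin_nonneg hρ hx j

/-- The special clause for `d j = 1` is redundant on `setH`: the top function is then `b 0` itself.
-/
lemma mem_setS_iff (hρ : 0 < ρ) {x : X} :
    x ∈ setS f h d α ρ ↔
      x ∈ setH f h d α ρ ∧ ∀ j i, i + 2 ≤ d j → 0 ≤ bSeq f (α j) (h j) i x := by
  refine and_congr_right fun hx => ?_
  simp only [setC, mem_iInter, setCj]
  refine forall_congr' fun j => ?_
  split_ifs with hj
  · have h1 := bSeq_top_nonneg hρ hx j
    rw [hj] at h1
    exact ⟨fun _ i hi => by omega, fun _ => h1⟩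
  · rfl

/-- On the set `setS`, all constraint functions are nonnegative. -/
lemma constraint_nonneg_of_mem_setS (hρ : 0 < ρ) {x : X}
    (hx : x ∈ setS f h d α ρ) (j : ι) : 0 ≤ h j x := by
  rw [mem_setS_iff hρ] at hx
  rcases Nat.lt_or_ge (d j) 2 with hj | hj
  · have h1 := bSeq_top_nonneg hρ hx.1 j
    rwa [show d j - 1 = 0 by omega] at h1
  · exact hx.2 j 0 hj

/-- If the input does not act on the `b_{j, i}` with `i ≤ d_j - 2` near points of `setS`, and acts on
the composite function at the points of `setB`, then `setS` is control forward invariant. -/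
theorem controlForwardInvariant_setS [FiniteDimensional ℝ X] (hf : Continuous f)
    (hg : Continuous g) (hρ : 0 < ρ)
    (hα : ∀ j i, i + 2 ≤ d j → IsExtendedClassK (α j i))
    (hb : ∀ j i, i + 2 ≤ d j → ContDiff ℝ 1 (bSeq f (α j) (h j) i))
    (hh : ContDiff ℝ 1 (composite f h d α ρ))
    (hB : ∀ p ∈ setB f h d α ρ, lieG g (composite f h d α ρ) p ≠ 0)
    (hrel : ∀ p ∈ setS f h d α ρ, ∀ j i, i + 2 ≤ d j →
      ∀ᶠ q in 𝓝 p, lieG g (bSeq f (α j) (h j) i) q = 0) :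
    ControlForwardInvariant f g (setS f h d α ρ) := by
  obtain ⟨u, hu, hu'⟩ := exists_feedback (S := setH f h d α ρ) hf hg hh
    fun x hx hx' => hB x ⟨hx, hx'⟩
  refine ⟨u, hu, fun x₀ hx₀ T x hx => ?_⟩
  have hH : ∀ t ∈ Ico 0 T, x t ∈ setH f h d α ρ := hx.mem_superlevel hh hu' hx₀.1
  have hcont : ContinuousOn x (Ico 0 T) := fun t ht =>
    (hx.2 t ht).continuousWithinAt.mono fun s hs => hs.1
  have hclosed : IsClosed (setS f h d α ρ) := by
    have : setS f h d α ρ = setH f h d α ρ ∩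
        ⋂ (j) (i) (_ : i + 2 ≤ d j), {x | 0 ≤ bSeq f (α j) (h j) i x} := by
      ext y
      simp [mem_setS_iff hρ]
    rw [this]
    exact (isClosed_le continuous_const hh.continuous).inter
      (isClosed_iInter fun j => isClosed_iInter fun i => isClosed_iInter fun hi =>
        isClosed_le continuous_const (hb j i hi).continuous)
  refine forall_mem_of_forall_eventually_mem hclosed hcont (by rwa [hx.1]) fun s hs hsS => ?_
  have hle : 𝓝[≥] s ≤ 𝓝[Ici 0] s := nhdsWithin_mono s fun t ht => hs.1.trans ht
  -- The input is known not to act only near points of `setS`, so the argument runs on a short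
  -- interval after `s` and is continued by continuous induction.
  have hev : ∀ᶠ t in 𝓝[≥] s, ∀ j, ∀ i ∈ Finset.range (d j), i + 2 ≤ d j →
      lieG g (bSeq f (α j) (h j) i) (x t) = 0 := by
    rw [eventually_all]
    intro j
    rw [Finset.eventually_all]
    intro i _
    by_cases hi : i + 2 ≤ d j
    · filter_upwards [hle ((hx.2 s hs).continuousWithinAt.eventually (hrel _ hsS j i hi))]
        with t ht _ using ht
    · exact Eventually.of_forall fun t h => absurd h hi
  obtain ⟨e₀, he₀, hsub⟩ := mem_nhdsGE_iff_exists_Ico_subset.mp hev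
  set e := min e₀ T with he
  have hse : s < e := lt_min he₀ hs.2
  have hT : ∀ t ∈ Ico s e, t ∈ Ico 0 T := fun t ht =>
    ⟨hs.1.trans ht.1, ht.2.trans_le (min_le_right _ _)⟩
  rw [mem_setS_iff hρ] at hsS
  -- Descending induction from the top function, whose sign the soft minimum controls.
  have hkey : ∀ j k, k + 1 ≤ d j → ∀ t ∈ Ico s e, 0 ≤ bSeq f (α j) (h j) (d j - 1 - k) (x t) := by
    intro j k
    induction k with
    | zero => exact fun _ t ht => bSeq_top_nonneg hρ (hH t (hT t ht)) j
    | succ k ih =>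
      intro hk
      have ih := ih (by omega)
      obtain ⟨i, hi⟩ : ∃ i, i = d j - 1 - (k + 1) := ⟨_, rfl⟩
      rw [show d j - 1 - k = i + 1 by omega] at ih
      rw [← hi]
      have hi2 : i + 2 ≤ d j := by omega
      refine nonneg_of_hasDerivWithinAt (a := α j i)
        (c := fun t => bSeq f (α j) (h j) (i + 1) (x t)) hs.1 (fun t ht => ?_) ih
        (fun z hz => ?_) (hsS.2 j i hi2)
      · have h1 := ((hb j i hi2).differentiable (by norm_num) (x t)).hasFDerivAt.comp_hasDerivWithinAt
          t (hx.2 t (hT t ht))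
        rw [lieD_add_lieG, hsub ⟨ht.1, ht.2.trans_le (min_le_left _ _)⟩ j i
          (Finset.mem_range.mpr (by omega)) hi2] at h1
        refine h1.congr_deriv ?_
        simp [bSeq]
      · obtain ⟨_, hmono, h0⟩ := hα j i hi2
        exact h0 ▸ (hmono hz).le
  filter_upwards [Ioo_mem_nhdsGT hse] with t ht
  have ht' : t ∈ Ico s e := ⟨ht.1.le, ht.2⟩
  rw [mem_setS_iff hρ]
  refine ⟨hH t (hT t ht'), fun j i hi => ?_⟩
  have := hkey j (d j - 1 - i) (by omega) t ht'
  rwa [show d j - 1 - (d j - 1 - i) = i by omega] at this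

end Invariance

end SoftMinCBF

theorem mainTheorem5 {n nc m ℓ ℓu : ℕ}
    -- the plant and its constraint functions
    (f : EuclideanSpace ℝ (Fin n) → EuclideanSpace ℝ (Fin n))
    (g : EuclideanSpace ℝ (Fin n) → EuclideanSpace ℝ (Fin m) →L[ℝ] EuclideanSpace ℝ (Fin n))
    (hf : LocallyLipschitz f) (hg : LocallyLipschitz g)
    (h : Fin ℓ → EuclideanSpace ℝ (Fin n) → ℝ) (d : Fin ℓ → ℕ)
    (hA1 : SoftMinCBF.CondA1 f g h d)
    -- the control dynamics and the input constraint functions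
    (fc : EuclideanSpace ℝ (Fin nc) → EuclideanSpace ℝ (Fin nc))
    (gc : EuclideanSpace ℝ (Fin nc) → EuclideanSpace ℝ (Fin m) →L[ℝ] EuclideanSpace ℝ (Fin nc))
    (hc : EuclideanSpace ℝ (Fin nc) → EuclideanSpace ℝ (Fin m))
    (hfc : LocallyLipschitz fc) (hgc : LocallyLipschitz gc) (hhc : LocallyLipschitz hc)
    (φ : Fin ℓu → EuclideanSpace ℝ (Fin m) → ℝ) (hφ : ∀ κ, ContDiff ℝ 1 (φ κ))
    (dc ζ : ℕ)
    (hC1 : SoftMinCBF.CondC1 fc gc hc dc) (hC2 : SoftMinCBF.CondC2 fc gc hc φ ζ)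
    -- the class-K functions and the parameter of the soft minimum
    (α : Fin ℓ ⊕ Fin ℓu → ℕ → ℝ → ℝ)
    (hα : ∀ j i, i + 2 ≤ SoftMinCBF.cascadeDegree (Fin ℓu) d dc ζ j →
      SoftMinCBF.IsExtendedClassK (α j i) ∧ LocallyLipschitz (α j i))
    (ρ : ℝ) (hρ : 0 < ρ)
    -- the derivatives of the cascade functions that occur exist and are continuous
    (hb : ∀ j i, i + 2 ≤ SoftMinCBF.cascadeDegree (Fin ℓu) d dc ζ j →
      ContDiff ℝ 1 (SoftMinCBF.bSeq (SoftMinCBF.cascadeDrift f g fc hc) (α j)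
        (SoftMinCBF.cascadeConstraint h φ hc j) i))
    (hh : ContDiff ℝ 1 (SoftMinCBF.composite (SoftMinCBF.cascadeDrift f g fc hc)
      (SoftMinCBF.cascadeConstraint h φ hc) (SoftMinCBF.cascadeDegree (Fin ℓu) d dc ζ) α ρ))
    -- the derivative of the composite function is locally Lipschitz on its superlevel set
    (hLip : LocallyLipschitzOn
      (SoftMinCBF.setH (SoftMinCBF.cascadeDrift f g fc hc)
        (SoftMinCBF.cascadeConstraint h φ hc) (SoftMinCBF.cascadeDegree (Fin ℓu) d dc ζ) α ρ)
      (fderiv ℝ (SoftMinCBF.composite (SoftMinCBF.cascadeDrift f g fc hc)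
        (SoftMinCBF.cascadeConstraint h φ hc) (SoftMinCBF.cascadeDegree (Fin ℓu) d dc ζ) α ρ)))
    (hB : ∀ p ∈ SoftMinCBF.setB (SoftMinCBF.cascadeDrift f g fc hc)
        (SoftMinCBF.cascadeConstraint h φ hc) (SoftMinCBF.cascadeDegree (Fin ℓu) d dc ζ) α ρ,
      SoftMinCBF.lieG (SoftMinCBF.cascadeInput (EuclideanSpace ℝ (Fin n)) gc)
        (SoftMinCBF.composite (SoftMinCBF.cascadeDrift f g fc hc)
          (SoftMinCBF.cascadeConstraint h φ hc) (SoftMinCBF.cascadeDegree (Fin ℓu) d dc ζ) α ρ)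
        p ≠ 0) :
    SoftMinCBF.ControlForwardInvariant (SoftMinCBF.cascadeDrift f g fc hc)
      (SoftMinCBF.cascadeInput (EuclideanSpace ℝ (Fin n)) gc)
      (SoftMinCBF.setS (SoftMinCBF.cascadeDrift f g fc hc)
        (SoftMinCBF.cascadeConstraint h φ hc) (SoftMinCBF.cascadeDegree (Fin ℓu) d dc ζ) α ρ) := by
  have hdrift : Continuous (SoftMinCBF.cascadeDrift f g fc hc) :=
    ((hf.continuous.comp continuous_fst).add ((hg.continuous.comp continuous_fst).clm_apply
      (hhc.continuous.comp continuous_snd))).prodMk (hfc.continuous.comp continuous_snd)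
  have hinput : Continuous (SoftMinCBF.cascadeInput (EuclideanSpace ℝ (Fin n)) gc) :=
    continuous_const.clm_comp (hgc.continuous.comp continuous_snd)
  refine SoftMinCBF.controlForwardInvariant_setS hdrift hinput hρ
    (fun j i hi => (hα j i hi).1) hb hh hB fun p hp j i hi => ?_
  -- The nonvanishing conditions in A1 and C2 hold only where the constraints do, which this
  -- provides at `p`.
  have hpos := SoftMinCBF.constraint_nonneg_of_mem_setS hρ hp
  rcases j with j | κ
  · obtain ⟨hd, hA, hA0, hA'⟩ := hA1 j
    obtain ⟨hdc, hC, hC0, hC'⟩ := hC1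
    have hbij := (Module.End.isUnit_iff _).mp ((hC' p.2).map ContinuousLinearMap.toLinearMapRingHom)
    exact SoftMinCBF.eventually_lieG_bSeq_fst hf hg.continuous hfc hgc.continuous hd hdc hA hA0
      (hA' p.1 fun j' => hpos (Sum.inl j')) hC hC0 hbij.2 (fun i hi => hb (Sum.inl j) i hi) hi
  · obtain ⟨hC, hC0, hC'⟩ := hC2.2 κ
    exact SoftMinCBF.eventually_lieG_bSeq_snd hfc hgc.continuous hC hC0
      (hC' p.2 fun κ' => hpos (Sum.inr κ')) (fun i hi => hb (Sum.inr κ) i hi) hi
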